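/- Let $k$ be an algebraically closed field. For a finite-dimensional $k$-algebra $\Lambda$ let $\operatorname{mod}\Lambda$ be the category of finite-dimensional left $\Lambda$-modules, and let $\operatorname{rad}$ be the ideal of $\operatorname{mod}\Lambda$ generated by all non-invertible maps between indecomposable modules. For a class $\mathcal C$ of $\Lambda$-modules let $\operatorname{add}\mathcal C$ be its closure under finite direct sums and direct summands, and let $\operatorname{Hom}(X,\mathcal C,Y)$ be the set of all maps $X\to Y$ that factor through a module in $\operatorname{add}\mathcal C$. The algebra $\Lambda$ is called controlled wild if for every finite-dimensional $k$-algebra $\Gamma$ there are a $k$-linear exact embedding (that is, faithful) functor $F\colon \operatorname{mod}\Gamma\to\operatorname{mod}\Lambda$ and a full subcategory $\mathcal C$ of $\operatorname{mod}\Lambda$ such that for all $\Gamma$-modules $X,Y$ one has $\operatorname{Hom}(FX,\mathcal C,FY)\subseteq \operatorname{rad}(FX,FY)$ and $$\operatorname{Hom}(FX,FY)=F\operatorname{Hom}(X,Y)\oplus \operatorname{Hom}(FX,\mathcal C,FY).$$ For a finite-dimensional $k$-algebra $R$, a dimension vector $\mathbf e$ is a function from the set of isomorphism classes of simple $R$-modules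 to the non-negative integers, and for a finite-dimensional $R$-module $M$ the quiver Grassmannian $\mathbb G_{\mathbf e}(M)$ is the set of all submodules $U$ of $M$ in which every simple module $S$ has Jordan–Hölder multiplicity $\mathbf e_S$, considered as a projective variety by the Plücker embedding. For $D,Y\in\operatorname{mod}\Lambda$ the space $\operatorname{Hom}(D,Y)$ is a module over $\Gamma(D)=\operatorname{End}(D)^{\mathrm{op}}$ by composition of maps. Proposition 1. Let $\Lambda$ be a finite-dimensional $k$-algebra which is controlled wild, and let $V$ be any projective variety over $k$, that is, a Zariski closed subset of some projective space $\mathbb P^n(k)$. Then there are finite-dimensional $\Lambda$-modules $D,Y$ and a dimension vector $\mathbf e$ for $\Gamma(D)$ such that the Auslander variety $\mathbb G_{\mathbf e}\operatorname{Hom}(D,Y)$ is isomorphic to $V$ as a variety. -/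

import Mathlib

open CategoryTheory CategoryTheory.Limits

universe w v u

namespace AuslanderVariety

/-! ## Projective varieties over an algebraically closed field and their isomorphisms -/

section Projective

variable {k : Type u} [Field k]

/-- A subset of `ℙⁿ(k)` is a projective variety (a Zariski closed subset) if it is the set of
common zeros of a set of homogeneous polynomials in `n + 1` variables. -/
def IsProjectiveVariety {n : ℕ} (V : Set (Projectivization k (Fin (n + 1) → k))) : Prop :=
  ∃ S : Set (MvPolynomial (Fin (n + 1)) k), (∀ f ∈ S, ∃ d : ℕ, f.IsHomogeneous d) ∧
    V = {x | ∀ f ∈ S, MvPolynomial.eval x.rep f = 0}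

/-- `f : W → k` is a form of degree `m` on the vector space `W`: a homogeneous polynomial
of degree `m` in linear functionals on `W`. -/
def IsForm {W : Type v} [AddCommGroup W] [Module k W] (m : ℕ) (f : W → k) : Prop :=
  ∃ p : MvPolynomial (Module.Dual k W) k, p.IsHomogeneous m ∧
    ∀ x : W, f x = MvPolynomial.eval (fun l : Module.Dual k W => l x) p

/-- A map from a subset `X` of the projective space `ℙ(W)` to the projective space `ℙ(W')` is
regular if around every point of `X` it is of the form `[x] ↦ [F x]`, where all coordinates of
`F : W → W'` are forms of one and the same degree (the neighbourhood being the set of points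
of `X` where `F` does not vanish). -/
def IsRegular {W : Type v} [AddCommGroup W] [Module k W] {W' : Type w} [AddCommGroup W']
    [Module k W'] {X : Set (Projectivization k W)} (φ : X → Projectivization k W') : Prop :=
  ∀ x : X, ∃ (m : ℕ) (F : W → W'),
    (∀ l : Module.Dual k W', IsForm m (fun y => l (F y))) ∧ F x.1.rep ≠ 0 ∧
    ∀ (y : X) (hy : F y.1.rep ≠ 0), φ y = Projectivization.mk k (F y.1.rep) hy

/-- Two subvarieties of projective spaces are isomorphic: there are mutually inverse regular maps
between them. -/
def Isomorphic {W : Type v} [AddCommGroup W] [Module k W] {W' : Type w} [AddCommGroup W']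
    [Module k W'] (X : Set (Projectivization k W)) (Y : Set (Projectivization k W')) : Prop :=
  ∃ φ : X ≃ Y, IsRegular (fun x => (φ x : Projectivization k W')) ∧
    IsRegular (fun y => (φ.symm y : Projectivization k W))

end Projective

/-! ## Dimension vectors and quiver Grassmannians -/

section Grassmannian

/-- Isomorphism of simple modules. -/
def simpleSetoid (R : Type u) [Ring R] : Setoid {S : ModuleCat.{u} R // IsSimpleModule R S} where
  r S T := Nonempty (S.1 ≃ₗ[R] T.1)
  iseqv := ⟨fun S => ⟨LinearEquiv.refl R S.1⟩, fun ⟨f⟩ => ⟨f.symm⟩, fun ⟨f⟩ ⟨g⟩ => ⟨f.trans g⟩⟩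

/-- A dimension vector for `R`: a function from the set of isomorphism classes of simple
`R`-modules to the natural numbers. -/
def DimensionVector (R : Type u) [Ring R] : Type (u + 1) := Quotient (simpleSetoid R) → ℕ

/-- The number of factors isomorphic to `S` in a composition series of submodules of `M`. -/
noncomputable def jhMultiplicity {R : Type u} [Ring R] {M : Type v} [AddCommGroup M] [Module R M]
    (s : CompositionSeries (Submodule R M)) (S : Type u) [AddCommGroup S] [Module R S] : ℕ :=
  Nat.card {i : Fin s.length //
    Nonempty ((s i.succ ⧸ (s i.castSucc).submoduleOf (s i.succ)) ≃ₗ[R] S)}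

/-- The submodule `U` of `M` has dimension vector `e`: it has a composition series in which every
simple module `S` occurs with multiplicity `e S`. -/
def HasDimensionVector {R : Type u} [Ring R] {M : Type v} [AddCommGroup M] [Module R M]
    (U : Submodule R M) (e : DimensionVector R) : Prop :=
  ∃ s : CompositionSeries (Submodule R M), s.head = ⊥ ∧ s.last = U ∧
    ∀ S : {S : ModuleCat.{u} R // IsSimpleModule R S},
      jhMultiplicity s S.1 = e (Quotient.mk (simpleSetoid R) S)

theorem jhMultiplicity_eq_of_equivalent {R : Type u} [Ring R] {M : Type v} [AddCommGroup M]
    [Module R M] {s t : CompositionSeries (Submodule R M)} (h : s.Equivalent t)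
    (S : Type u) [AddCommGroup S] [Module R S] : jhMultiplicity s S = jhMultiplicity t S := by
  obtain ⟨f, hf⟩ := h
  refine Nat.card_congr (f.subtypeEquiv fun i => ?_)
  have g := JordanHolderLattice.Iso.linearEquiv (hf i)
  exact ⟨fun ⟨a⟩ => ⟨g.symm.trans a⟩, fun ⟨a⟩ => ⟨g.trans a⟩⟩

/-- The dimension vector of a submodule is unique (Jordan-Hölder). -/
theorem HasDimensionVector.unique {R : Type u} [Ring R] {M : Type v} [AddCommGroup M] [Module R M]
    {U : Submodule R M} {e e' : DimensionVector R} (h : HasDimensionVector U e)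
    (h' : HasDimensionVector U e') : e = e' := by
  obtain ⟨s, hs, hs', hse⟩ := h
  obtain ⟨t, ht, ht', hte⟩ := h'
  funext S
  induction S using Quotient.inductionOn with
  | h S =>
    rw [← hse S, ← hte S]
    exact jhMultiplicity_eq_of_equivalent
      (CompositionSeries.jordan_holder s t (hs.trans ht.symm) (hs'.trans ht'.symm)) S.1

variable {k : Type w} [Field k]

theorem wedge_ne_zero {M : Type v} [AddCommGroup M] [Module k M] {d : ℕ} {b : Fin d → M}
    (hb : LinearIndependent k b) : ExteriorAlgebra.ιMulti k d b ≠ 0 := by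
  have h := (exteriorPower.ιMulti_family_linearIndependent_field (n := d) hb).ne_zero
    (Set.powersetCard.ofFinEmbEquiv (RelEmbedding.refl _))
  intro h0
  apply h
  apply Subtype.ext
  rw [exteriorPower.ιMulti_family_apply_coe, ExteriorAlgebra.ιMulti_family, Equiv.symm_apply_apply]
  exact h0

/-- The Plücker point `[b₁ ∧ ⋯ ∧ b_d]` of the subspace with basis `b₁, …, b_d`. It lies in the
projective space of the `d`-th exterior power of `M`, a linear subspace of the projective space of
the exterior algebra. -/
noncomputable def pluckerPoint {M : Type v} [AddCommGroup M] [Module k M] {d : ℕ} (b : Fin d → M)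
    (hb : LinearIndependent k b) : Projectivization k (ExteriorAlgebra k M) :=
  Projectivization.mk k (ExteriorAlgebra.ιMulti k d b) (wedge_ne_zero hb)

/-- The quiver Grassmannian `𝔾_e(M)` of a module `M` over a `k`-algebra `R`: the set of all
submodules of `M` with dimension vector `e`, as a subvariety of a projective space by the Plücker
embedding. (All submodules with dimension vector `e` have the same dimension `d` over `k`.) -/
def quiverGrassmannian (k : Type w) [Field k] {R : Type u} [Ring R] [Algebra k R]
    (M : Type v) [AddCommGroup M] [Module k M] [Module R M] [IsScalarTower k R M]
    (e : DimensionVector R) : Set (Projectivization k (ExteriorAlgebra k M)) :=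
  {x | ∃ U : Submodule R M, HasDimensionVector U e ∧
    ∃ (d : ℕ) (b : Fin d → M) (hb : LinearIndependent k b),
      Submodule.span k (Set.range b) = U.restrictScalars k ∧ x = pluckerPoint b hb}

end Grassmannian

/-! ## Controlled wild algebras -/

section Controlled

variable {A : Type u} [Category.{v} A] [Preadditive A] [HasZeroObject A] [HasBinaryBiproducts A]

/-- The class `add C`: the closure of `C` under (finite, possibly empty) direct sums and direct
summands. -/
inductive AddClosure (C : ObjectProperty A) : A → Prop
  | of (X : A) (h : C X) : AddClosure C X
  | zero (X : A) (h : IsZero X) : AddClosure C X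
  | sum (X Y : A) (hX : AddClosure C X) (hY : AddClosure C Y) : AddClosure C (X ⊞ Y)
  | summand (X Y Z : A) (i : Z ≅ X ⊞ Y) (h : AddClosure C Z) : AddClosure C X

variable (k : Type w) [Field k] [Linear k A]

/-- `Hom(X, C, Y)`: the maps `X ⟶ Y` which factor through an object of `add C`. -/
def homThrough (C : ObjectProperty A) (X Y : A) : Submodule k (X ⟶ Y) where
  carrier := {f | ∃ Z : A, AddClosure C Z ∧ ∃ (g : X ⟶ Z) (h : Z ⟶ Y), f = g ≫ h}
  zero_mem' := by
    obtain ⟨Z, hZ⟩ := HasZeroObject.zero (C := A)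
    exact ⟨Z, .zero Z hZ, 0, 0, by simp⟩
  add_mem' := by
    rintro _ _ ⟨Z, hZ, g, h, rfl⟩ ⟨Z', hZ', g', h', rfl⟩
    exact ⟨Z ⊞ Z', .sum _ _ hZ hZ', biprod.lift g g', biprod.desc h h', by simp⟩
  smul_mem' := by
    rintro c _ ⟨Z, hZ, g, h, rfl⟩
    exact ⟨Z, hZ, c • g, h, by simp⟩

/-- `rad(X, Y)`: the ideal generated by all non-invertible maps between indecomposable objects. -/
def radical (X Y : A) : Submodule k (X ⟶ Y) :=
  Submodule.span k {f | ∃ (I J : A) (p : X ⟶ I) (g : I ⟶ J) (q : J ⟶ Y),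
    Indecomposable I ∧ Indecomposable J ∧ ¬ IsIso g ∧ f = p ≫ g ≫ q}

end Controlled

section FiniteModules

variable {R : Type u} [Ring R]

instance : HasZeroObject (FGModuleCat.{v} R) :=
  ⟨⟨FGModuleCat.of R PUnit, (IsZero.iff_id_eq_zero _).mpr (by ext)⟩⟩

instance : HasBinaryBiproducts (FGModuleCat.{v} R) :=
  ⟨fun X Y => hasBinaryBiproduct_of_total
    { pt := FGModuleCat.of R (X × Y)
      fst := FGModuleCat.ofHom (LinearMap.fst R X Y)
      snd := FGModuleCat.ofHom (LinearMap.snd R X Y)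
      inl := FGModuleCat.ofHom (LinearMap.inl R X Y)
      inr := FGModuleCat.ofHom (LinearMap.inr R X Y)
      inl_fst := FGModuleCat.hom_ext (LinearMap.fst_comp_inl R X Y)
      inl_snd := FGModuleCat.hom_ext (LinearMap.snd_comp_inl R X Y)
      inr_fst := FGModuleCat.hom_ext (LinearMap.fst_comp_inr R X Y)
      inr_snd := FGModuleCat.hom_ext (LinearMap.snd_comp_inr R X Y) }
    (FGModuleCat.hom_ext (LinearMap.ext fun x => by
      change (x.1, (0 : Y)) + ((0 : X), x.2) = x
      simp))⟩

/-- A controlled embedding `F : mod Γ ⥤ mod Λ` with control class `C`: an exact embedding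
(faithful, `k`-linear) functor such that for all `X`, `Y` the space `Hom(FX, C, FY)` is contained
in `rad(FX, FY)` and is a complement in `Hom(FX, FY)` of the image of `Hom(X, Y)` under `F`. -/
structure IsControlledEmbedding (k : Type u) [Field k] {Γ Λ : Type u} [Ring Γ] [Algebra k Γ]
    [Ring Λ] [Algebra k Λ] (F : FGModuleCat.{u} Γ ⥤ FGModuleCat.{u} Λ)
    (C : ObjectProperty (FGModuleCat.{u} Λ)) : Prop where
  additive : F.Additive
  linear : F.Linear k
  faithful : F.Faithful
  preservesFiniteLimits : PreservesFiniteLimits F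
  preservesFiniteColimits : PreservesFiniteColimits F
  homThrough_le_radical (X Y : FGModuleCat.{u} Γ) :
    homThrough k C (F.obj X) (F.obj Y) ≤ radical k (F.obj X) (F.obj Y)
  isCompl (X Y : FGModuleCat.{u} Γ) :
    IsCompl (LinearMap.range (F.mapLinearMap k : (X ⟶ Y) →ₗ[k] (F.obj X ⟶ F.obj Y)))
      (homThrough k C (F.obj X) (F.obj Y))

/-- The `k`-algebra `Λ` is controlled wild: for every finite-dimensional `k`-algebra `Γ` there is
a controlled embedding of the category `mod Γ` of finite-dimensional `Γ`-modules into `mod Λ`. Over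
a finite-dimensional algebra the finite-dimensional modules are the finitely generated ones. -/
def IsControlledWild (k : Type u) [Field k] (Λ : Type u) [Ring Λ] [Algebra k Λ] : Prop :=
  ∀ (Γ : Type u) [Ring Γ] [Algebra k Γ] [FiniteDimensional k Γ],
    ∃ (F : FGModuleCat.{u} Γ ⥤ FGModuleCat.{u} Λ) (C : ObjectProperty (FGModuleCat.{u} Λ)),
      IsControlledEmbedding k F C

end FiniteModules

/-! ## Auslander varieties -/

/-- The action of `Γ(D) = End(D)ᵒᵖ` on `Hom(D, Y)` by composition is compatible with scalars. -/
instance (k : Type w) [Field k] {A : Type u} [Category.{v} A] [Preadditive A] [Linear k A]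
    (D Y : A) : IsScalarTower k (End D)ᵐᵒᵖ (D ⟶ Y) where
  smul_assoc c r f := Linear.smul_comp D D Y c r.unop f

/-- The Auslander variety `𝔾_e Hom(D, Y)`, where `Hom(D, Y)` is a module over
`Γ(D) = End(D)ᵒᵖ` by composition of maps. -/
noncomputable def auslanderVariety (k : Type u) [Field k] {Λ : Type u} [Ring Λ] [Algebra k Λ]
    (D Y : FGModuleCat.{u} Λ) (e : DimensionVector (End D)ᵐᵒᵖ) :
    Set (Projectivization k (ExteriorAlgebra k (D ⟶ Y))) :=
  quiverGrassmannian k (R := (End D)ᵐᵒᵖ) (D ⟶ Y) e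

end AuslanderVariety

/-! Two constructions are combined. The first presents a nonempty `V` as a variety of stable
subspaces. After multiplying its equations by powers of the coordinates, `V` is cut out by a space
`I` of forms of a single degree `d + 1`. Put `A = I^⊥`, a space of functionals on these forms, and
let `Γ` act on `X = A × k^(n+1)` through the two projections and the contractions by forms of degree
`d`. A stable subspace of dimension type `(1, 1)` is `⟨T⟩ × ⟨w⟩` with every contraction of `T` a
multiple of `w`. By `eq_smul_evalForm`, `T` is then proportional to evaluation at `w`, and that
evaluation lies in `I^⊥` exactly when `[w] ∈ V`.

The second transports this to `mod Λ`. For a controlled embedding `F`, put `Q = FΓ` and `Y = FX`.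
Then `Hom(Q, Y) = X ⊕ Hom(Q, C, Y)`, and one `Z` in `add C` suffices to factor all of `Hom(Q, C,
Y)`. For `D = Q ⊞ Z`, the module `H = Hom(D, Y)` maps onto `X`, with `End(D)ᵒᵖ` acting on `X`
through `Γ`; the kernel is generated by `e • H`, where `e` is the idempotent belonging to `Z`
(`isRealization_biprod`).

A dimension vector determines `dim r • U` for every idempotent `r`
(`HasDimensionVector.smulRank_eq`). So a submodule `U` with the dimension vector of the preimage of
some `⟨T⟩ × ⟨w⟩` satisfies `e • U = e • H`, contains the kernel, and is itself the preimage of a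
stable subspace of type `(1, 1)` (`IsRealization.exists_eq_comap`). Conversely, all these preimages
share one dimension vector, being built from the kernel by adding two lines with fixed characters.
Finally, the Plücker vector of the preimage has coordinates of degree `d + 2` in `w`, and linear
maps recover `w` from it locally, so the bijection with `V` is biregular. -/

namespace AuslanderVariety

/-! ### Composition series and Jordan-Hölder multiplicities -/

section CompositionSeries

theorem card_subtype_fin_succ {n : ℕ} (p : Fin (n + 1) → Prop) [Decidable (p (Fin.last n))] :
    Nat.card {i // p i} =
      Nat.card {i : Fin n // p i.castSucc} + if p (Fin.last n) then 1 else 0 := by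
  classical
  simp only [Nat.card_eq_fintype_card, Fintype.card_subtype, Finset.card_filter,
    Fin.sum_univ_castSucc]
  congr

variable {R : Type u} [Ring R] {H : Type v} [AddCommGroup H] [Module R H]

open Classical in
theorem jhMultiplicity_snoc (s : CompositionSeries (Submodule R H)) (B : Submodule R H)
    (h : s.last ⋖ B) (S : Type u) [AddCommGroup S] [Module R S] :
    jhMultiplicity (s.snoc B h) S = jhMultiplicity s S +
      if Nonempty ((B ⧸ s.last.submoduleOf B) ≃ₗ[R] S) then 1 else 0 := by
  let P : Submodule R H → Submodule R H → Prop :=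
    fun A B => Nonempty ((B ⧸ A.submoduleOf B) ≃ₗ[R] S)
  let t : CompositionSeries (Submodule R H) := s.snoc B h
  have key := card_subtype_fin_succ (n := s.length) (fun i => P (t i.castSucc) (t i.succ))
  have h1 : ∀ i : Fin (s.length + 1), t i.castSucc = s i := fun i =>
    RelSeries.snoc_castSucc s B h i
  have h2 : t (Fin.last (s.length + 1)) = B := RelSeries.last_snoc s B h
  have h3 : ∀ i : Fin s.length, t i.castSucc.succ = s i.succ := fun i => h1 i.succ
  refine key.trans ?_
  simp only [h1, h3, Fin.succ_last, h2]
  rfl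

/-- Composition series with the same multiplicities have matching composition factors. -/
theorem exists_equiv_of_jhMultiplicity_eq {H : Type u} [AddCommGroup H] [Module R H]
    (s t : CompositionSeries (Submodule R H))
    (h : ∀ S : {S : ModuleCat.{u} R // IsSimpleModule R S},
      jhMultiplicity s S.1 = jhMultiplicity t S.1) :
    ∃ f : Fin s.length ≃ Fin t.length, ∀ i, Nonempty
      ((s i.succ ⧸ (s i.castSucc).submoduleOf (s i.succ)) ≃ₗ[R]
        (t (f i).succ ⧸ (t (f i).castSucc).submoduleOf (t (f i).succ))) := by
  have hsimple : ∀ (s : CompositionSeries (Submodule R H)) (i : Fin s.length),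
      IsSimpleModule R (s i.succ ⧸ (s i.castSucc).submoduleOf (s i.succ)) := fun s i =>
    (covBy_iff_quot_is_simple (s.lt_succ i).le).1 (s.step i)
  let q (s : CompositionSeries (Submodule R H)) (i : Fin s.length) :
      Quotient (simpleSetoid R) := Quotient.mk (simpleSetoid R)
    ⟨ModuleCat.of R (s i.succ ⧸ (s i.castSucc).submoduleOf (s i.succ)), hsimple s i⟩
  have hq : ∀ (s : CompositionSeries (Submodule R H)) (i : Fin s.length) S,
      q s i = Quotient.mk (simpleSetoid R) S ↔
        Nonempty ((s i.succ ⧸ (s i.castSucc).submoduleOf (s i.succ)) ≃ₗ[R] S.1) :=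
    fun s i S => Quotient.eq (r := simpleSetoid R)
  -- Equal multiplicities make the fibres over each isomorphism class equinumerous; the fibrewise
  -- bijections are then glued.
  have hcard : ∀ c, Nonempty ({i // q s i = c} ≃ {j // q t j = c}) := by
    intro c
    induction c using Quotient.inductionOn with
    | h S =>
      have hS := h S
      unfold jhMultiplicity at hS
      obtain ⟨e⟩ := (Finite.card_eq).1 hS
      exact ⟨((Equiv.subtypeEquivRight fun i => hq s i S).trans e).trans
        (Equiv.subtypeEquivRight fun i => hq t i S).symm⟩
  let e := fun c => (hcard c).some
  refine ⟨Equiv.ofFiberEquiv e, fun i => ?_⟩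
  exact (hq s i _).1 (Equiv.ofFiberEquiv_map e i).symm

end CompositionSeries

/-! ### Idempotents and dimension vectors -/

section Idempotent

variable (k : Type w) [Field k] {R : Type u} [Ring R] [Algebra k R]

/-- The dimension of `r • U`. -/
noncomputable def smulRank {H : Type v} [AddCommGroup H] [Module k H] [Module R H]
    [IsScalarTower k R H] (r : R) (U : Submodule R H) : ℕ :=
  Module.finrank k ((U.restrictScalars k).map (Algebra.lsmul k k H r))

variable {H : Type v} [AddCommGroup H] [Module k H] [Module R H]
  [IsScalarTower k R H] [FiniteDimensional k H]

/-- Multiplication by an idempotent is exact: `r` fixes `r • B` pointwise, so `r • B ∩ A = r • A`,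
and this is the kernel of the map from `r • B` onto `r • (B / A)`. -/
theorem smulRank_eq_add {r : R} (hr : r * r = r) {A B : Submodule R H} (hAB : A ≤ B) :
    smulRank k r B = smulRank k r A +
      Module.finrank k (LinearMap.range (Algebra.lsmul k k (B ⧸ A.submoduleOf B) r)) := by
  let f : (B.restrictScalars k) →ₗ[k] (B ⧸ A.submoduleOf B) :=
    ((A.submoduleOf B).mkQ).restrictScalars k
  have hrB : ∀ x : H, x ∈ B → r • x ∈ B := fun x hx => B.smul_mem r hx
  let V : Submodule k H := (B.restrictScalars k).map (Algebra.lsmul k k H r)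
  have hVB : V ≤ B.restrictScalars k := by
    rintro _ ⟨x, hx, rfl⟩
    exact hrB x hx
  let g : V →ₗ[k] (B ⧸ A.submoduleOf B) := f ∘ₗ Submodule.inclusion hVB
  have hrange : LinearMap.range g =
      LinearMap.range (Algebra.lsmul k k (B ⧸ A.submoduleOf B) r) := by
    apply le_antisymm
    · rintro _ ⟨⟨_, x, hx, rfl⟩, rfl⟩
      exact ⟨(A.submoduleOf B).mkQ ⟨x, hx⟩, rfl⟩
    · rintro _ ⟨y, rfl⟩
      obtain ⟨x, rfl⟩ := (A.submoduleOf B).mkQ_surjective y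
      exact ⟨⟨r • (x : H), ⟨x, x.2, rfl⟩⟩, rfl⟩
  have hker : Module.finrank k (LinearMap.ker g) = smulRank k r A := by
    have hmap : (LinearMap.ker g).map V.subtype =
        (A.restrictScalars k).map (Algebra.lsmul k k H r) := by
      apply le_antisymm
      · rintro _ ⟨⟨_, x, hx, rfl⟩, hy, rfl⟩
        have h0 : r • x ∈ A := by
          have hy' : (Submodule.Quotient.mk (⟨r • x, hrB x hx⟩ : B) : B ⧸ A.submoduleOf B) = 0 := hy
          exact (Submodule.Quotient.mk_eq_zero (A.submoduleOf B)).1 hy'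
        refine ⟨r • x, h0, ?_⟩
        simp [← mul_smul, hr]
      · rintro _ ⟨x, hx, rfl⟩
        refine ⟨⟨r • x, ⟨x, hAB hx, rfl⟩⟩, ?_, rfl⟩
        have : (Submodule.Quotient.mk (⟨r • x, hrB x (hAB hx)⟩ : B) : B ⧸ A.submoduleOf B) = 0 :=
          (Submodule.Quotient.mk_eq_zero (A.submoduleOf B)).2 (A.smul_mem r hx)
        exact this
    rw [smulRank, ← hmap]
    exact (Submodule.finrank_map_subtype_eq V _).symm
  have := LinearMap.finrank_range_add_finrank_ker g
  rw [hker, hrange] at this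
  rw [add_comm]
  exact this.symm

/-- Telescoping of `smulRank_eq_add`, carried out in `ℤ` to allow differences. Only the composition
factors remain on the right. -/
theorem smulRank_last {r : R} (hr : r * r = r) (s : CompositionSeries (Submodule R H))
    (hs : s.head = ⊥) :
    smulRank k r s.last = ∑ i : Fin s.length, Module.finrank k (LinearMap.range
      (Algebra.lsmul k k (s i.succ ⧸ (s i.castSucc).submoduleOf (s i.succ)) r)) := by
  have h : ∀ i : Fin s.length, (smulRank k r (s i.succ) : ℤ) - smulRank k r (s i.castSucc) =
      Module.finrank k (LinearMap.range
      (Algebra.lsmul k k (s i.succ ⧸ (s i.castSucc).submoduleOf (s i.succ)) r)) := fun i => by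
    rw [smulRank_eq_add k hr (s.lt_succ i).le]
    push_cast
    ring
  have h0 : smulRank k r s.head = 0 := by
    rw [hs, smulRank, Submodule.restrictScalars_bot, Submodule.map_bot, finrank_bot]
  have hsum := Fin.sum_univ_succ (fun i : Fin (s.length + 1) => (smulRank k r (s i) : ℤ))
  have hsum' := Fin.sum_univ_castSucc (fun i : Fin (s.length + 1) => (smulRank k r (s i) : ℤ))
  have : (smulRank k r (s (Fin.last _)) : ℤ) = ∑ i : Fin s.length,
      ((smulRank k r (s i.succ) : ℤ) - smulRank k r (s i.castSucc)) := by
    rw [Finset.sum_sub_distrib]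
    change smulRank k r (s 0) = 0 at h0
    rw [h0] at hsum
    push_cast at hsum
    linarith
  simp only [h] at this
  exact_mod_cast this

theorem finrank_range_lsmul_congr {Q Q' : Type*} [AddCommGroup Q] [Module k Q] [Module R Q]
    [IsScalarTower k R Q] [AddCommGroup Q'] [Module k Q'] [Module R Q'] [IsScalarTower k R Q']
    (e : Q ≃ₗ[R] Q') (r : R) :
    Module.finrank k (LinearMap.range (Algebra.lsmul k k Q r)) =
      Module.finrank k (LinearMap.range (Algebra.lsmul k k Q' r)) := by
  let e' : Q ≃ₗ[k] Q' := e.restrictScalars k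
  rw [← LinearEquiv.finrank_map_eq e']
  have : (LinearMap.range (Algebra.lsmul k k Q r)).map (e' : Q →ₗ[k] Q') =
      LinearMap.range (Algebra.lsmul k k Q' r) := by
    ext y
    constructor
    · rintro ⟨_, ⟨x, rfl⟩, rfl⟩
      exact ⟨e x, (map_smul e r x).symm⟩
    · rintro ⟨x, rfl⟩
      exact ⟨r • e.symm x, ⟨e.symm x, rfl⟩, by simp [e']⟩
  rw [this]

/-- The dimension vector of `U` determines the dimension of `r • U` for every idempotent `r`. -/
theorem HasDimensionVector.smulRank_eq {H : Type u} [AddCommGroup H] [Module k H] [Module R H]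
    [IsScalarTower k R H] [FiniteDimensional k H] {r : R} (hr : r * r = r) {U U' : Submodule R H}
    {e : DimensionVector R} (h : HasDimensionVector U e) (h' : HasDimensionVector U' e) :
    smulRank k r U = smulRank k r U' := by
  obtain ⟨s, hs, rfl, hse⟩ := h
  obtain ⟨t, ht, rfl, hte⟩ := h'
  obtain ⟨f, hf⟩ := exists_equiv_of_jhMultiplicity_eq s t fun S => (hse S).trans (hte S).symm
  rw [smulRank_last k hr s hs, smulRank_last k hr t ht, ← Equiv.sum_comp f]
  exact Finset.sum_congr rfl fun i _ => finrank_range_lsmul_congr k (hf i).some r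

end Idempotent

/-! ### Extensions by one-dimensional modules -/

section OneDimensional

section LineExtension

variable {k : Type w} [Field k] {R : Type u} [Ring R]
variable {H : Type v} [AddCommGroup H] [Module k H] [Module R H]

/-- `B` is the sum of `A` and the line through `v ∉ A`. -/
structure IsLineExtension (A B : Submodule R H) (v : H) : Prop where
  notMem : v ∉ A
  mem_iff : ∀ x, x ∈ B ↔ ∃ c : k, x - c • v ∈ A

theorem IsLineExtension.le {A B : Submodule R H} {v : H}
    (h : IsLineExtension (k := k) A B v) : A ≤ B :=
  fun x hx => (h.mem_iff x).2 ⟨0, by simpa using hx⟩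

theorem IsLineExtension.mem {A B : Submodule R H} {v : H}
    (h : IsLineExtension (k := k) A B v) : v ∈ B := (h.mem_iff v).2 ⟨1, by simp⟩

end LineExtension

variable {k : Type w} [Field k] {R : Type u} [Ring R] [Algebra k R]

/-- A one-dimensional module is determined by the character through which the algebra acts on a
generator. -/
theorem nonempty_linearEquiv_of_eigenvector {Q Q' : Type*} [AddCommGroup Q] [Module k Q]
    [Module R Q] [IsScalarTower k R Q] [AddCommGroup Q'] [Module k Q'] [Module R Q']
    [IsScalarTower k R Q'] {q : Q} {q' : Q'} (hq : q ≠ 0) (hq' : q' ≠ 0)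
    (htop : ∀ x : Q, ∃ c : k, c • q = x) (htop' : ∀ x : Q', ∃ c : k, c • q' = x)
    (χ : R → k) (h : ∀ r : R, r • q = χ r • q) (h' : ∀ r : R, r • q' = χ r • q') :
    Nonempty (Q ≃ₗ[R] Q') := by
  have hcomm : ∀ {P : Type _} [AddCommGroup P] [Module k P] [Module R P] [IsScalarTower k R P]
      (r : R) (c : k) (x : P), r • c • x = c • r • x := by
    intro P _ _ _ _ r c x
    exact ((Algebra.lsmul k k P) r).map_smul c x
  have hcomm' : ∀ (r : R) (c : k) (x : Q'), r • c • x = c • r • x := by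
    intro r c x
    exact ((Algebra.lsmul k k Q') r).map_smul c x
  let e : k ≃ₗ[k] Q := LinearEquiv.ofBijective (LinearMap.toSpanSingleton k Q q)
    ⟨by
      rw [injective_iff_map_eq_zero]
      intro c hc
      simpa [hq] using hc, fun x => htop x⟩
  let e' : k ≃ₗ[k] Q' := LinearEquiv.ofBijective (LinearMap.toSpanSingleton k Q' q')
    ⟨by
      rw [injective_iff_map_eq_zero]
      intro c hc
      simpa [hq'] using hc, fun x => htop' x⟩
  have he : ∀ c, e c = c • q := fun c => rfl
  have he' : ∀ c, e' c = c • q' := fun c => rfl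
  refine ⟨{ (e.symm.trans e') with map_smul' := fun r x => ?_ }⟩
  obtain ⟨c, rfl⟩ := e.surjective x
  have h1 : r • e c = e (χ r * c) := by
    rw [he, hcomm, h, smul_smul, he, mul_comm]
  change e' (e.symm (r • e c)) = r • e' (e.symm (e c))
  rw [h1, e.symm_apply_apply, e.symm_apply_apply, he', he', hcomm', h', smul_smul, mul_comm]

variable {H : Type v} [AddCommGroup H] [Module k H] [Module R H] [IsScalarTower k R H]

theorem IsLineExtension.covBy {A B : Submodule R H} {v : H}
    (h : IsLineExtension (k := k) A B v) : A ⋖ B := by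
  refine ⟨lt_of_le_of_ne h.le fun hAB => h.notMem (hAB ▸ h.mem), fun C hAC hCB => ?_⟩
  obtain ⟨x, hxC, hxA⟩ := SetLike.exists_of_lt hAC
  obtain ⟨c, hc⟩ := (h.mem_iff x).1 (hCB.le hxC)
  have hc0 : c ≠ 0 := by
    rintro rfl
    exact hxA (by simpa using hc)
  have hcv : c • v ∈ C := by
    have := C.sub_mem hxC (hAC.le hc)
    simpa using this
  have hv : v ∈ C := by
    have := (C.restrictScalars k).smul_mem c⁻¹ hcv
    simpa [smul_smul, hc0] using this
  apply hCB.not_ge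
  intro y hy
  obtain ⟨b, hb⟩ := (h.mem_iff y).1 hy
  have := C.add_mem (hAC.le hb) ((C.restrictScalars k).smul_mem b hv)
  simpa using this

theorem IsLineExtension.nonempty_linearEquiv {A B A' B' : Submodule R H} {v v' : H}
    (h : IsLineExtension (k := k) A B v) (h' : IsLineExtension (k := k) A' B' v')
    (χ : R → k) (hχ : ∀ r : R, r • v - χ r • v ∈ A) (hχ' : ∀ r : R, r • v' - χ r • v' ∈ A') :
    Nonempty ((B ⧸ A.submoduleOf B) ≃ₗ[R] (B' ⧸ A'.submoduleOf B')) := by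
  have aux : ∀ {A B : Submodule R H} {v : H} (h : IsLineExtension (k := k) A B v)
      (_ : ∀ r : R, r • v - χ r • v ∈ A),
      (A.submoduleOf B).mkQ ⟨v, h.mem⟩ ≠ 0 ∧
      (∀ x, ∃ c : k, c • (A.submoduleOf B).mkQ ⟨v, h.mem⟩ = x) ∧
      ∀ r : R, r • (A.submoduleOf B).mkQ ⟨v, h.mem⟩ = χ r • (A.submoduleOf B).mkQ ⟨v, h.mem⟩ := by
    intro A B v h hχ
    refine ⟨fun h0 => ?_, fun x => ?_, fun r => ?_⟩
    · rw [Submodule.mkQ_apply, Submodule.Quotient.mk_eq_zero] at h0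
      exact h.notMem h0
    · obtain ⟨⟨x, hx⟩, rfl⟩ := (A.submoduleOf B).mkQ_surjective x
      obtain ⟨c, hc⟩ := (h.mem_iff x).1 hx
      have hc' : (⟨x, hx⟩ - c • ⟨v, h.mem⟩ : B) ∈ A.submoduleOf B := hc
      exact ⟨c, ((Submodule.Quotient.eq (A.submoduleOf B)).2 hc').symm⟩
    · have hr : (r • ⟨v, h.mem⟩ - χ r • ⟨v, h.mem⟩ : B) ∈ A.submoduleOf B := hχ r
      exact (Submodule.Quotient.eq (A.submoduleOf B)).2 hr
  obtain ⟨h1, h2, h3⟩ := aux h hχ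
  obtain ⟨h1', h2', h3'⟩ := aux h' hχ'
  exact nonempty_linearEquiv_of_eigenvector h1 h1' h2 h2' χ h3 h3'

end OneDimensional

/-! ### Independence of the Plücker point from the basis -/

section Plucker

variable {k : Type w} [Field k] {M : Type v} [AddCommGroup M] [Module k M]

/-- The Plücker point only depends on the span of the basis. -/
theorem pluckerPoint_eq_of_span_eq {d d' : ℕ} {b : Fin d → M} {b' : Fin d' → M}
    (hb : LinearIndependent k b) (hb' : LinearIndependent k b')
    (h : Submodule.span k (Set.range b) = Submodule.span k (Set.range b')) :
    pluckerPoint b hb = pluckerPoint b' hb' := by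
  obtain rfl : d = d' := by
    have h1 := finrank_span_eq_card hb
    have h2 := finrank_span_eq_card hb'
    rw [h, h2] at h1
    simpa using h1.symm
  let U := Submodule.span k (Set.range b')
  let e : Module.Basis (Fin d) k U := Module.Basis.span hb'
  have he : ∀ i, (e i : M) = b' i := fun i => by
    exact congrArg Subtype.val (Module.Basis.span_apply hb' i)
  have hmem : ∀ i, b i ∈ U := fun i => by
    have : b i ∈ Submodule.span k (Set.range b) := Submodule.subset_span ⟨i, rfl⟩
    rwa [h] at this
  let c : Fin d → U := fun i => ⟨b i, hmem i⟩
  let f : U [⋀^Fin d]→ₗ[k] ExteriorAlgebra k M :=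
    (ExteriorAlgebra.ιMulti k d).compLinearMap U.subtype
  let g : U [⋀^Fin d]→ₗ[k] ExteriorAlgebra k M :=
    ((LinearMap.toSpanSingleton k _ (ExteriorAlgebra.ιMulti k d b'))).compAlternatingMap e.det
  have hfe : f e = ExteriorAlgebra.ιMulti k d b' := by
    change ExteriorAlgebra.ιMulti k d (fun i => (e i : M)) = _
    simp only [he]
  -- Alternating maps on `U` are determined by their values on tuples of basis vectors. Comparing
  -- the two at `b` yields the base change determinant as the scalar between the wedges.
  have hfg : f = g := by
    refine Module.Basis.ext_alternating e fun v hv => ?_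
    let σ : Equiv.Perm (Fin d) := Equiv.ofBijective v (Finite.injective_iff_bijective.1 hv)
    have h1 : f (fun i => e (v i)) = Equiv.Perm.sign σ • f e := f.map_perm e σ
    have h2 : e.det (fun i => e (v i)) = Equiv.Perm.sign σ • e.det e := e.det.map_perm e σ
    change f _ = e.det _ • ExteriorAlgebra.ιMulti k d b'
    rw [h1, h2, hfe, e.det_self, Units.smul_def, Units.smul_def, smul_assoc, one_smul]
  have hfc : ExteriorAlgebra.ιMulti k d b = e.det c • ExteriorAlgebra.ιMulti k d b' := by
    have : f c = g c := by rw [hfg]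
    exact this
  rw [pluckerPoint, pluckerPoint, Projectivization.mk_eq_mk_iff']
  exact ⟨e.det c, hfc.symm⟩

end Plucker

/-! ### Forms, evaluation functionals and contractions -/

section Forms

variable {k : Type u} [Field k]

theorem isForm_dual {k : Type w} [Field k] {W : Type v} [AddCommGroup W] [Module k W]
    (l : Module.Dual k W) :
    IsForm 1 l :=
  ⟨MvPolynomial.X l, MvPolynomial.isHomogeneous_X k l, fun x => by simp⟩

theorem isForm_eval {n m : ℕ} (p : MvPolynomial (Fin n) k) (hp : p.IsHomogeneous m) :
    IsForm m (fun x : Fin n → k => MvPolynomial.eval x p) :=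
  ⟨MvPolynomial.rename (fun i => LinearMap.proj i) p, hp.rename_isHomogeneous, fun x => by
    rw [MvPolynomial.eval_rename]
    rfl⟩

variable (k) in
/-- Homogeneous polynomials of degree `d` in `n + 1` variables. -/
abbrev Forms (n d : ℕ) : Submodule k (MvPolynomial (Fin (n + 1)) k) :=
  MvPolynomial.homogeneousSubmodule (Fin (n + 1)) k d

instance (n d : ℕ) : FiniteDimensional k (Forms k n d) :=
  Module.Finite.iff_fg.2 (MvPolynomial.homogeneousSubmodule_fg (Fin (n + 1)) k d)

variable {n d : ℕ}

/-- Evaluation of forms of degree `d` at the vector `x`. -/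
noncomputable def evalForm (d : ℕ) (x : Fin (n + 1) → k) : Module.Dual k (Forms k n d) :=
  (MvPolynomial.aeval x).toLinearMap ∘ₗ (Forms k n d).subtype

@[simp]
theorem evalForm_apply (x : Fin (n + 1) → k) (f : Forms k n d) :
    evalForm d x f = MvPolynomial.eval x f.1 := by
  simp [evalForm, MvPolynomial.aeval_eq_eval]

theorem evalForm_smul (c : k) (x : Fin (n + 1) → k) :
    evalForm d (c • x) = c ^ d • evalForm d x := by
  ext f
  have hf : f.1.IsHomogeneous d := f.2
  simp only [evalForm_apply, LinearMap.smul_apply, smul_eq_mul]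
  rw [MvPolynomial.eval_eq, MvPolynomial.eval_eq, Finset.mul_sum]
  refine Finset.sum_congr rfl fun m hm => ?_
  have h := hf (MvPolynomial.mem_support_iff.1 hm)
  have hd : ∑ i, m i = d := by
    rw [← h, Finsupp.weight_apply, Finsupp.sum_fintype _ _ (by simp)]
    simp
  have hc : ∏ i ∈ m.support, c ^ m i = c ^ d := by
    rw [Finset.prod_pow_eq_pow_sum, ← hd]
    congr 1
    exact Finset.sum_subset (Finset.subset_univ _) fun i _ hi => by simpa using hi
  simp only [Pi.smul_apply, smul_eq_mul, mul_pow, Finset.prod_mul_distrib, hc]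
  ring

theorem evalForm_ne_zero {x : Fin (n + 1) → k} (hx : x ≠ 0) : evalForm d x ≠ 0 := by
  obtain ⟨i, hi⟩ := Function.ne_iff.1 hx
  intro h
  have := LinearMap.congr_fun h ⟨MvPolynomial.X i ^ d, MvPolynomial.isHomogeneous_X_pow i d⟩
  rw [evalForm_apply] at this
  simp only [map_pow, MvPolynomial.eval_X, LinearMap.zero_apply] at this
  exact pow_ne_zero d hi this

theorem isForm_bilinear_evalForm
    (B : Module.Dual k (Forms k n d) →ₗ[k] (Fin (n + 1) → k) →ₗ[k] k) :
    IsForm (d + 1) (fun x => B (evalForm d x) x) := by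
  -- A functional on the dual of the finite-dimensional space of forms is evaluation at a form. So
  -- `B` paired with the `i`-th unit vector is a form `f i`, and the whole expression is `∑ f i * X
  -- i`.
  let f : Fin (n + 1) → Forms k n d := fun i =>
    (Module.evalEquiv k (Forms k n d)).symm (B.flip (Pi.single i 1))
  have hf : ∀ i x, MvPolynomial.eval x (f i).1 = B (evalForm d x) (Pi.single i 1) := by
    intro i x
    rw [← evalForm_apply, Module.apply_evalEquiv_symm_apply, LinearMap.flip_apply]
  have hp : (∑ i, (f i).1 * MvPolynomial.X i).IsHomogeneous (d + 1) :=
    MvPolynomial.IsHomogeneous.sum _ _ _ fun i _ =>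
      MvPolynomial.IsHomogeneous.mul (f i).2 (MvPolynomial.isHomogeneous_X k i)
  convert isForm_eval _ hp using 2 with x
  rw [map_sum]
  simp only [map_mul, MvPolynomial.eval_X, hf]
  conv_lhs => rw [LinearMap.pi_apply_eq_sum_univ (B (evalForm d x)) x]
  refine Finset.sum_congr rfl fun i _ => ?_
  rw [smul_eq_mul, mul_comm]
  congr 2
  ext j
  simp [Pi.single_apply, eq_comm]

/-- The contraction of a functional on forms of degree `d + 1` by a form of degree `d`. -/
noncomputable def contraction (q : Forms k n d) :
    Module.Dual k (Forms k n (d + 1)) →ₗ[k] (Fin (n + 1) → k) :=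
  LinearMap.pi fun i => Module.Dual.eval k (Forms k n (d + 1))
    ⟨q.1 * MvPolynomial.X i, MvPolynomial.IsHomogeneous.mul q.2 (MvPolynomial.isHomogeneous_X k i)⟩

theorem contraction_apply (q : Forms k n d) (T : Module.Dual k (Forms k n (d + 1)))
    (i : Fin (n + 1)) : contraction q T i = T ⟨q.1 * MvPolynomial.X i,
      MvPolynomial.IsHomogeneous.mul q.2 (MvPolynomial.isHomogeneous_X k i)⟩ := rfl

theorem contraction_evalForm (q : Forms k n d) (x : Fin (n + 1) → k) :
    contraction q (evalForm (d + 1) x) = MvPolynomial.eval x q.1 • x := by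
  ext i
  rw [contraction_apply, evalForm_apply]
  simp

theorem homogeneousComponent_mul_X {σ : Type*} (d : ℕ) (q : MvPolynomial σ k) (i : σ) :
    MvPolynomial.homogeneousComponent (d + 1) (q * MvPolynomial.X i) =
      MvPolynomial.homogeneousComponent d q * MvPolynomial.X i := by
  classical
  ext m
  rw [MvPolynomial.coeff_homogeneousComponent, MvPolynomial.coeff_mul_X',
    MvPolynomial.coeff_mul_X', MvPolynomial.coeff_homogeneousComponent]
  by_cases hi : i ∈ m.support
  · obtain ⟨m', rfl⟩ : ∃ m', m = m' + Finsupp.single i 1 := by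
      refine ⟨m - Finsupp.single i 1, (tsub_add_cancel_of_le ?_).symm⟩
      rw [Finsupp.single_le_iff]
      exact Nat.one_le_iff_ne_zero.2 (Finsupp.mem_support_iff.1 hi)
    simp [hi, map_add]
  · simp [hi]

/-- Linear functionals on forms all of whose contractions are multiples of `w` are multiples of
the evaluation at `w`. -/
theorem eq_smul_evalForm (T : Module.Dual k (Forms k n (d + 1))) {w : Fin (n + 1) → k}
    (hw : w ≠ 0) (h : ∀ q : Forms k n d, ∃ a : k, contraction q T = a • w) :
    ∃ c : k, T = c • evalForm (d + 1) w := by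
  obtain ⟨i₀, hi₀⟩ := Function.ne_iff.1 hw
  change w i₀ ≠ 0 at hi₀
  -- Extending `T` by zero on the other degrees lets the induction below run over all polynomials
  -- without tracking degrees.
  let T' : MvPolynomial (Fin (n + 1)) k →ₗ[k] k := T ∘ₗ LinearMap.codRestrict (Forms k n (d + 1))
    (MvPolynomial.homogeneousComponent (d + 1))
    (fun p => MvPolynomial.homogeneousComponent_isHomogeneous (d + 1) p)
  have hT' : ∀ p : Forms k n (d + 1), T' p.1 = T p := fun p => by
    change T _ = T p
    congr 1
    ext1
    exact MvPolynomial.homogeneousComponent_eq_self p.2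
  have hmul : ∀ q : MvPolynomial (Fin (n + 1)) k, ∃ a : k, ∀ i,
      T' (q * MvPolynomial.X i) = a * w i := by
    intro q
    obtain ⟨a, ha⟩ := h ⟨_, MvPolynomial.homogeneousComponent_isHomogeneous d q⟩
    refine ⟨a, fun i => ?_⟩
    have hi := congrFun ha i
    rw [contraction_apply] at hi
    refine Eq.trans ?_ hi
    change T _ = T _
    congr 1
    ext1
    exact homogeneousComponent_mul_X d q i
  -- Cross-multiplication eliminates the unknown factor `a`: a variable `X i` may be traded for `X
  -- i₀` at the cost of `w i / w i₀`.
  have hswap : ∀ (q : MvPolynomial (Fin (n + 1)) k) i,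
      T' (q * MvPolynomial.X i) * w i₀ = T' (q * MvPolynomial.X i₀) * w i := by
    intro q i
    obtain ⟨a, ha⟩ := hmul q
    rw [ha, ha]
    ring
  -- Trading all variables of a monomial in this way expresses its value under `T'` by that of a
  -- power of `X i₀`.
  have hmon : ∀ (l : List (Fin (n + 1))) (q : MvPolynomial (Fin (n + 1)) k),
      T' (q * (l.map MvPolynomial.X).prod) * w i₀ ^ l.length =
        T' (q * MvPolynomial.X i₀ ^ l.length) * (l.map w).prod := by
    intro l
    induction l with
    | nil => simp
    | cons i l ih =>
      intro q
      have h1 := ih (q * MvPolynomial.X i₀)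
      have h2 := hswap (q * (l.map MvPolynomial.X).prod) i
      simp only [List.map_cons, List.prod_cons, List.length_cons]
      have e1 : q * (MvPolynomial.X i * (l.map MvPolynomial.X).prod) =
        q * (l.map MvPolynomial.X).prod * MvPolynomial.X i := by ring
      have e2 : q * MvPolynomial.X i₀ * (l.map MvPolynomial.X).prod =
        q * (l.map MvPolynomial.X).prod * MvPolynomial.X i₀ := by ring
      have e3 : q * MvPolynomial.X i₀ ^ (l.length + 1) =
        q * MvPolynomial.X i₀ * MvPolynomial.X i₀ ^ l.length := by ring
      rw [e1, e3, pow_succ]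
      rw [e2] at h1
      linear_combination (w i₀ ^ l.length) * h2 + w i * h1
  -- The only possible constant, obtained by testing on `X i₀ ^ (d + 1)`.
  let c : k := T' (MvPolynomial.X i₀ ^ (d + 1)) * (w i₀ ^ (d + 1))⁻¹
  refine ⟨c, ?_⟩
  have hlin : ∀ p : MvPolynomial (Fin (n + 1)) k, p.IsHomogeneous (d + 1) →
      T' p = c * MvPolynomial.eval w p := by
    intro p hp
    rw [p.as_sum, map_sum, map_sum, Finset.mul_sum]
    refine Finset.sum_congr rfl fun m hm => ?_
    have hdeg := hp (MvPolynomial.mem_support_iff.1 hm)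
    have hlen : (Finsupp.toMultiset m).toList.length = d + 1 := by
      rw [Multiset.length_toList, Finsupp.card_toMultiset, ← hdeg, Finsupp.weight_apply]
      simp [Finsupp.sum]
    have hX : MvPolynomial.monomial m (1 : k) =
        ((Finsupp.toMultiset m).toList.map MvPolynomial.X).prod := by
      rw [← Multiset.prod_coe, ← Multiset.map_coe, Multiset.coe_toList,
        MvPolynomial.monomial_eq, map_one, one_mul, Finsupp.toMultiset_map,
        Finsupp.prod_toMultiset, Finsupp.prod_mapDomain_index (by simp) (by simp [pow_add])]
    have hm1 := hmon (Finsupp.toMultiset m).toList 1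
    rw [hlen, one_mul, one_mul, ← hX] at hm1
    have hmw : MvPolynomial.eval w (MvPolynomial.monomial m (1 : k)) =
        ((Finsupp.toMultiset m).toList.map w).prod := by
      rw [hX, map_list_prod, List.map_map]
      congr 2
      ext i
      simp
    have hmc : MvPolynomial.monomial m (p.coeff m) =
        p.coeff m • MvPolynomial.monomial m (1 : k) := by
      rw [MvPolynomial.smul_monomial, smul_eq_mul, mul_one]
    rw [hmc, map_smul, MvPolynomial.smul_eval, hmw, smul_eq_mul]
    have : T' (MvPolynomial.monomial m 1) = c * ((Finsupp.toMultiset m).toList.map w).prod := by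
      have hne := pow_ne_zero (d + 1) hi₀
      apply mul_right_cancel₀ hne
      rw [hm1]
      simp only [c]
      field_simp
    rw [this]
    ring
  ext p
  rw [← hT', hlin p.1 p.2, LinearMap.smul_apply, evalForm_apply, smul_eq_mul]

/-- By Hilbert's basis theorem finitely many equations suffice. Multiplying each by the powers of
all coordinates that raise its degree to `d + 1` keeps the zero set, since some coordinate of a
point is nonzero. A positive degree leaves room for contractions by forms of degree `d`. -/
theorem IsProjectiveVariety.exists_dualAnnihilator
    {V : Set (Projectivization k (Fin (n + 1) → k))} (hV : IsProjectiveVariety V) :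
    ∃ (d : ℕ) (I : Submodule k (Forms k n (d + 1))),
      ∀ x, x ∈ V ↔ evalForm (d + 1) x.rep ∈ I.dualAnnihilator := by
  obtain ⟨S, hS, rfl⟩ := hV
  obtain ⟨S', hS'S, hspan⟩ := (Submodule.fg_span_iff_fg_span_finset_subset S).1
    ((isNoetherianRing_iff_ideal_fg _).1 inferInstance (Ideal.span S))
  choose! D hD using hS
  let d := S'.sup D
  have hd : ∀ f ∈ S', D f ≤ d := fun f hf => Finset.le_sup hf
  let I : Submodule k (Forms k n (d + 1)) := Submodule.span k
    {g | ∃ f ∈ S', ∃ i, g.1 = MvPolynomial.X i ^ (d + 1 - D f) * f}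
  refine ⟨d, I, fun x => ?_⟩
  have h1 : evalForm (d + 1) x.rep ∈ I.dualAnnihilator ↔
      ∀ f ∈ S', MvPolynomial.eval x.rep f = 0 := by
    rw [Submodule.mem_dualAnnihilator]
    constructor
    · intro h f hf
      obtain ⟨i, hi⟩ := Function.ne_iff.1 x.rep_nonzero
      have hhom : (MvPolynomial.X i ^ (d + 1 - D f) * f).IsHomogeneous (d + 1) := by
        have := (MvPolynomial.isHomogeneous_X_pow (R := k) i (d + 1 - D f)).mul (hD f (hS'S hf))
        rwa [Nat.sub_add_cancel ((hd f hf).trans d.le_succ)] at this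
      have := h ⟨_, hhom⟩ (Submodule.subset_span ⟨f, hf, i, rfl⟩)
      rw [evalForm_apply] at this
      simp only [map_mul, map_pow, MvPolynomial.eval_X] at this
      exact (mul_eq_zero.1 this).resolve_left (pow_ne_zero _ hi)
    · intro h g hg
      induction hg using Submodule.span_induction with
      | mem g hg =>
        obtain ⟨f, hf, i, hgf⟩ := hg
        rw [evalForm_apply, hgf, map_mul, h f hf, mul_zero]
      | zero => simp
      | add a b _ _ ha hb => rw [map_add, ha, hb, add_zero]
      | smul c a _ ha => rw [map_smul, ha, smul_zero]
  rw [h1]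
  constructor
  · exact fun h f hf => h f (hS'S hf)
  · intro h f hf
    have hle : Ideal.span (S' : Set (MvPolynomial (Fin (n + 1)) k)) ≤
        RingHom.ker (MvPolynomial.eval x.rep) :=
      Ideal.span_le.2 fun f hf => h f hf
    have : f ∈ Ideal.span S := Ideal.subset_span hf
    rw [show Ideal.span S = Ideal.span (S' : Set (MvPolynomial (Fin (n + 1)) k)) from hspan] at this
    exact hle this

end Forms

/-! ### The contraction algebra and its stable subspaces -/

section ContractionAlgebra

variable {k : Type u} [Field k] {n d : ℕ}

theorem contraction_zero : contraction (0 : Forms k n d) = 0 := by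
  ext T i
  rw [contraction_apply]
  simp only [ZeroMemClass.coe_zero, zero_mul]
  exact T.map_zero

theorem contraction_add (q q' : Forms k n d) :
    contraction (q + q') = contraction q + contraction q' := by
  ext T i
  rw [LinearMap.add_apply, Pi.add_apply, contraction_apply, contraction_apply, contraction_apply,
    ← map_add]
  congr 1
  ext1
  exact add_mul _ _ _

theorem contraction_smul (c : k) (q : Forms k n d) :
    contraction (c • q) = c • contraction q := by
  ext T i
  rw [LinearMap.smul_apply, Pi.smul_apply, contraction_apply, contraction_apply, ← map_smul]
  congr 1
  ext1
  exact smul_mul_assoc _ _ _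

variable {A : Type u} [AddCommGroup A] [Module k A]
  (ι : A →ₗ[k] Module.Dual k (Forms k n (d + 1)))

/-- The algebra of endomorphisms of `A × k^(n+1)` generated by the two projections and the
contractions. -/
def contractionAlgebra :
    Subalgebra k (Module.End k (A × (Fin (n + 1) → k))) where
  carrier := {g | ∃ (a b : k) (q : Forms k n d),
    ∀ m, g m = (a • m.1, b • m.2 + contraction q (ι m.1))}
  mul_mem' := by
    rintro g g' ⟨a, b, q, h⟩ ⟨a', b', q', h'⟩
    -- Contractions read the first factor and land in the second, so the composite of two of them
    -- vanishes and only the mixed terms survive.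
    refine ⟨a * a', b * b', b • q' + a' • q, fun m => ?_⟩
    rw [Module.End.mul_apply, h', h, contraction_add, contraction_smul, contraction_smul]
    refine Prod.ext (smul_smul _ _ _) ?_
    simp only [map_smul, LinearMap.add_apply, LinearMap.smul_apply]
    module
  add_mem' := by
    rintro g g' ⟨a, b, q, h⟩ ⟨a', b', q', h'⟩
    refine ⟨a + a', b + b', q + q', fun m => ?_⟩
    rw [LinearMap.add_apply, h', h, contraction_add]
    refine Prod.ext (add_smul _ _ _).symm ?_
    simp only [Prod.mk_add_mk, LinearMap.add_apply]
    module
  algebraMap_mem' := fun c => ⟨c, c, 0, fun m => by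
    rw [Module.algebraMap_end_apply, contraction_zero]
    exact Prod.ext rfl (by simp)⟩

variable {ι}

variable (ι) in
theorem exists_mem_contractionAlgebra_fst :
    ∃ g ∈ contractionAlgebra ι, ∀ m, g m = (m.1, 0) :=
  ⟨LinearMap.inl k _ _ ∘ₗ LinearMap.fst k _ _, ⟨1, 0, 0, fun m => by
    rw [contraction_zero]
    exact Prod.ext (one_smul _ _).symm (by simp)⟩, fun _ => rfl⟩

variable (ι) in
theorem exists_mem_contractionAlgebra_snd :
    ∃ g ∈ contractionAlgebra ι, ∀ m, g m = (0, m.2) :=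
  ⟨LinearMap.inr k _ _ ∘ₗ LinearMap.snd k _ _, ⟨0, 1, 0, fun m => by
    rw [contraction_zero]
    exact Prod.ext (zero_smul _ _).symm (by simp)⟩, fun _ => rfl⟩

variable (ι) in
theorem exists_mem_contractionAlgebra_contraction (q : Forms k n d) :
    ∃ g ∈ contractionAlgebra ι, ∀ m, g m = (0, contraction q (ι m.1)) :=
  ⟨LinearMap.inr k _ _ ∘ₗ contraction q ∘ₗ ι ∘ₗ LinearMap.fst k _ _,
    ⟨0, 0, q, fun m => Prod.ext (zero_smul _ _).symm (by simp)⟩, fun _ => rfl⟩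

theorem exists_eq_span_singleton {X : Type*} [AddCommGroup X] [Module k X] {F : Submodule k X}
    (h : Module.finrank k F = 1) : ∃ v, v ≠ 0 ∧ F = Submodule.span k {v} := by
  obtain ⟨⟨v, hvF⟩, hv, h⟩ := finrank_eq_one_iff'.1 h
  refine ⟨v, fun h0 => hv (Subtype.ext h0), le_antisymm (fun x hx => ?_) ?_⟩
  · obtain ⟨c, hc⟩ := h ⟨x, hx⟩
    exact Submodule.mem_span_singleton.2 ⟨c, congrArg Subtype.val hc⟩
  · rwa [Submodule.span_singleton_le_iff_mem]

theorem prod_stable {w : Fin (n + 1) → k} {T : A} (hT : ι T = evalForm (d + 1) w) :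
    ∀ g ∈ contractionAlgebra ι, ∀ m ∈ (Submodule.span k {T}).prod (Submodule.span k {w}),
      g m ∈ (Submodule.span k {T}).prod (Submodule.span k {w}) := by
  rintro g ⟨a, b, q, hg⟩ ⟨m₁, m₂⟩ ⟨h₁, h₂⟩
  rw [hg]
  refine ⟨Submodule.smul_mem _ _ h₁, Submodule.add_mem _ (Submodule.smul_mem _ _ h₂) ?_⟩
  obtain ⟨c, hc⟩ := Submodule.mem_span_singleton.1 h₁
  change c • T = m₁ at hc
  subst hc
  simp only [map_smul, hT, contraction_evalForm]
  exact Submodule.smul_mem _ _ (Submodule.smul_mem _ _ (Submodule.mem_span_singleton_self _))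

theorem eq_prod_map_of_stable {X Y : Type*} [AddCommGroup X] [Module k X] [AddCommGroup Y]
    [Module k Y] {E : Submodule k (X × Y)} (h₁ : ∀ m ∈ E, (m.1, 0) ∈ E)
    (h₂ : ∀ m ∈ E, (0, m.2) ∈ E) :
    E = (E.map (LinearMap.fst k X Y)).prod (E.map (LinearMap.snd k X Y)) := by
  refine le_antisymm (fun m hm => ⟨⟨m, hm, rfl⟩, ⟨m, hm, rfl⟩⟩) ?_
  rintro ⟨_, _⟩ ⟨⟨m, hm, rfl⟩, ⟨m', hm', rfl⟩⟩
  have := E.add_mem (h₁ m hm) (h₂ m' hm')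
  simpa using this

/-- Subspaces that are stable under the contraction algebra and have dimension `(1, 1)`. -/
theorem exists_eq_prod_of_stable (hι : Function.Injective ι)
    {E : Submodule k (A × (Fin (n + 1) → k))} (hE : ∀ g ∈ contractionAlgebra ι, ∀ m ∈ E, g m ∈ E)
    (h1 : Module.finrank k (E.map (LinearMap.fst k A (Fin (n + 1) → k))) = 1)
    (h2 : Module.finrank k (E.map (LinearMap.snd k A (Fin (n + 1) → k))) = 1) :
    ∃ (w : Fin (n + 1) → k) (T : A), w ≠ 0 ∧ ι T = evalForm (d + 1) w ∧
      E = (Submodule.span k {T}).prod (Submodule.span k {w}) := by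
  obtain ⟨T, hT0, hT⟩ := exists_eq_span_singleton h1
  obtain ⟨w, hw0, hw⟩ := exists_eq_span_singleton h2
  have hprod : E = (Submodule.span k {T}).prod (Submodule.span k {w}) := by
    rw [← hT, ← hw]
    obtain ⟨g₁, hg₁, h₁⟩ := exists_mem_contractionAlgebra_fst ι
    obtain ⟨g₂, hg₂, h₂⟩ := exists_mem_contractionAlgebra_snd ι
    exact eq_prod_map_of_stable (fun m hm => h₁ m ▸ hE g₁ hg₁ m hm)
      fun m hm => h₂ m ▸ hE g₂ hg₂ m hm
  clear h1 h2 hT hw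
  have hTE : (T, 0) ∈ E := by
    rw [hprod]
    exact ⟨Submodule.mem_span_singleton_self T, Submodule.zero_mem _⟩
  obtain ⟨c, hc⟩ := eq_smul_evalForm (ι T) hw0 fun q => by
    obtain ⟨g, hg, h⟩ := exists_mem_contractionAlgebra_contraction ι q
    have h := h _ ▸ hE g hg _ hTE
    rw [hprod, Submodule.mem_prod] at h
    obtain ⟨a, ha⟩ := Submodule.mem_span_singleton.1 h.2
    exact ⟨a, ha.symm⟩
  -- Injectivity of `ι` excludes `c = 0`, so the generator `T` of its line can be rescaled to become
  -- evaluation at `w` exactly.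
  have hc0 : c ≠ 0 := by
    rintro rfl
    exact hT0 (hι (by rw [hc, zero_smul, map_zero]))
  refine ⟨w, c⁻¹ • T, hw0, ?_, ?_⟩
  · rw [map_smul, hc, smul_smul, inv_mul_cancel₀ hc0, one_smul]
  · rw [hprod, Submodule.span_singleton_smul_eq (IsUnit.mk0 _ (inv_ne_zero hc0))]

end ContractionAlgebra

/-! ### Existence and comparison of dimension vectors -/

section DimensionVector

variable {R : Type u} [Ring R] {H : Type v} [AddCommGroup H] [Module R H]

theorem jhMultiplicity_congr (s : CompositionSeries (Submodule R H)) {S S' : Type u}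
    [AddCommGroup S] [Module R S] [AddCommGroup S'] [Module R S'] (e : S ≃ₗ[R] S') :
    jhMultiplicity s S = jhMultiplicity s S' :=
  Nat.card_congr (Equiv.subtypeEquivRight fun _ =>
    ⟨fun ⟨f⟩ => ⟨f.trans e⟩, fun ⟨f⟩ => ⟨f.trans e.symm⟩⟩)

theorem exists_hasDimensionVector_last (s : CompositionSeries (Submodule R H)) (hs : s.head = ⊥) :
    ∃ e : DimensionVector R, HasDimensionVector s.last e := by
  refine ⟨fun c => Quotient.liftOn c (fun S => jhMultiplicity s S.1) ?_, s, hs, rfl, fun S => rfl⟩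
  rintro S S' ⟨f⟩
  exact jhMultiplicity_congr s f

theorem exists_hasDimensionVector [IsNoetherian R H] [IsArtinian R H] (U : Submodule R H) :
    ∃ e : DimensionVector R, HasDimensionVector U e := by
  have : ∃ s : CompositionSeries (Submodule R H), s.head = ⊥ ∧ s.last = U := by
    induction U using WellFoundedLT.induction with
    | ind U ih =>
      by_cases hU : U = ⊥
      · exact ⟨RelSeries.singleton _ ⊥, rfl, hU.symm⟩
      · obtain ⟨A, hA⟩ := exists_covBy_of_wellFoundedGT (a := U) fun h => hU (isMin_iff_eq_bot.1 h)
        obtain ⟨s, hs, rfl⟩ := ih A hA.lt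
        exact ⟨s.snoc U hA, by simpa using hs, by simp⟩
  obtain ⟨s, hs, rfl⟩ := this
  exact exists_hasDimensionVector_last s hs

/-- The two added factors are one-dimensional with the same character `χ`, hence isomorphic. By
Jordan-Hölder the multiplicities of `B` may be read off a series through `A`, and those of `B'` then
agree with them. -/
theorem HasDimensionVector.of_lineExtension {k : Type w} [Field k] [Algebra k R] [Module k H]
    [IsScalarTower k R H] {A B A' B' : Submodule R H}
    {v v' : H} (h : IsLineExtension (k := k) A B v) (h' : IsLineExtension (k := k) A' B' v')
    (χ : R → k) (hχ : ∀ r : R, r • v - χ r • v ∈ A) (hχ' : ∀ r : R, r • v' - χ r • v' ∈ A')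
    {a b : DimensionVector R} (hA : HasDimensionVector A a) (hA' : HasDimensionVector A' a)
    (hB : HasDimensionVector B b) : HasDimensionVector B' b := by
  classical
  obtain ⟨e⟩ := h.nonempty_linearEquiv h' χ hχ hχ'
  obtain ⟨s, hs, rfl, hsa⟩ := hA
  obtain ⟨s', hs', rfl, hsa'⟩ := hA'
  obtain ⟨t, ht, rfl, htb⟩ := hB
  obtain ⟨c, u, hu, hu', huc⟩ := exists_hasDimensionVector_last (s.snoc t.last h.covBy)
    ((RelSeries.head_snoc _ _ _).trans hs)
  refine ⟨s'.snoc B' h'.covBy, (RelSeries.head_snoc _ _ _).trans hs',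
    RelSeries.last_snoc _ _ _, fun S => ?_⟩
  rw [← htb, jhMultiplicity_eq_of_equivalent (CompositionSeries.jordan_holder t
    (s.snoc t.last h.covBy) (ht.trans ((RelSeries.head_snoc _ _ _).trans hs).symm)
    (RelSeries.last_snoc _ _ _).symm), jhMultiplicity_snoc, jhMultiplicity_snoc, hsa, hsa']
  congr 1
  have : Nonempty ((t.last ⧸ s.last.submoduleOf t.last) ≃ₗ[R] S.1) ↔
      Nonempty ((B' ⧸ s'.last.submoduleOf B') ≃ₗ[R] S.1) :=
    ⟨fun ⟨f⟩ => ⟨e.symm.trans f⟩, fun ⟨f⟩ => ⟨e.trans f⟩⟩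
  simp only [this]

end DimensionVector

/-! ### Realizations and preimages of stable subspaces -/

section Realization

variable {k : Type w} [Field k] {R : Type u} [Ring R] [Algebra k R]
  {H : Type v} [AddCommGroup H] [Module k H] [Module R H] [IsScalarTower k R H]
  {X : Type*} [AddCommGroup X] [Module k X]

variable (R) in
/-- The `R`-module `H` has a submodule `ker p`, generated by `e • H` for an idempotent `e`, such
that `R` acts on the quotient `X` through the algebra `Γ`. -/
structure IsRealization (Γ : Subalgebra k (Module.End k X)) (p : H →ₗ[k] X) (s : X →ₗ[k] H) :
    Prop where
  apply_section (x : X) : p (s x) = x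
  exists_apply_smul (r : R) : ∃ g ∈ Γ, ∀ h, p (r • h) = g (p h)
  exists_lift (g : Module.End k X) (hg : g ∈ Γ) : ∃ r : R, ∀ h, p (r • h) = g (p h)
  exists_idempotent_lift (g : Module.End k X) (hg : g ∈ Γ) (hgg : g * g = g) :
    ∃ r : R, r * r = r ∧ ∀ h, p (r • h) = g (p h)
  exists_generator : ∃ e : R, e * e = e ∧ (∀ h, p (e • h) = 0) ∧
    ∀ U : Submodule R H, (∀ h, e • h ∈ U) → ∀ h, p h = 0 → h ∈ U

variable {Γ : Subalgebra k (Module.End k X)} {p : H →ₗ[k] X} {s : X →ₗ[k] H}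

/-- The preimage of a `Γ`-stable subspace. -/
def IsRealization.comap (hR : IsRealization R Γ p s) (E : Submodule k X)
    (hE : ∀ g ∈ Γ, ∀ m ∈ E, g m ∈ E) : Submodule R H where
  carrier := {h | p h ∈ E}
  add_mem' {a b} ha hb := by
    change p (a + b) ∈ E
    rw [map_add]
    exact E.add_mem ha hb
  zero_mem' := by
    change p 0 ∈ E
    rw [map_zero]
    exact E.zero_mem
  smul_mem' r h hh := by
    obtain ⟨g, hg, hr⟩ := hR.exists_apply_smul r
    change p (r • h) ∈ E
    rw [hr]
    exact hE g hg _ hh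

set_option linter.unusedSectionVars false in
theorem IsRealization.mem_comap (hR : IsRealization R Γ p s) {E : Submodule k X}
    {hE : ∀ g ∈ Γ, ∀ m ∈ E, g m ∈ E} {h : H} : h ∈ hR.comap E hE ↔ p h ∈ E := Iff.rfl

theorem bot_stable : ∀ g ∈ Γ, ∀ m ∈ (⊥ : Submodule k X), g m ∈ (⊥ : Submodule k X) := by
  intro g _ m hm
  rw [Submodule.mem_bot] at hm ⊢
  rw [hm, map_zero]

theorem IsRealization.isLineExtension (hR : IsRealization R Γ p s) {E E' : Submodule k X}
    (hE : ∀ g ∈ Γ, ∀ m ∈ E, g m ∈ E) (hE' : ∀ g ∈ Γ, ∀ m ∈ E', g m ∈ E') {x : X} (hx : x ∉ E)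
    (h : ∀ y, y ∈ E' ↔ ∃ c : k, y - c • x ∈ E) :
    IsLineExtension (k := k) (hR.comap E hE) (hR.comap E' hE') (s x) where
  notMem := by rwa [hR.mem_comap, hR.apply_section]
  mem_iff y := by
    rw [hR.mem_comap, h]
    simp only [hR.mem_comap, map_sub, map_smul, hR.apply_section]

variable [FiniteDimensional k H]

/-- The map `p` sends `r • p⁻¹(E)` onto `g(E)`. Its kernel there is `r • ker p`, because `r` is
idempotent. The first summand does not depend on `E`, so ranks of idempotents on preimages detect
the dimension of `g(E)`. -/
theorem IsRealization.smulRank_comap (hR : IsRealization R Γ p s) (E : Submodule k X)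
    (hE : ∀ g ∈ Γ, ∀ m ∈ E, g m ∈ E) {r : R} (hr : r * r = r) {g : Module.End k X}
    (hg : ∀ h, p (r • h) = g (p h)) :
    smulRank k r (hR.comap E hE) =
      smulRank k r (hR.comap ⊥ bot_stable) + Module.finrank k (E.map g) := by
  let V : Submodule k H := ((hR.comap E hE).restrictScalars k).map (Algebra.lsmul k k H r)
  let q : V →ₗ[k] X := p ∘ₗ V.subtype
  have hrange : LinearMap.range q = E.map g := by
    apply le_antisymm
    · rintro _ ⟨⟨_, x, hx, rfl⟩, rfl⟩
      exact ⟨p x, hx, (hg x).symm⟩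
    · rintro _ ⟨y, hy, rfl⟩
      refine ⟨⟨r • s y, s y, ?_, rfl⟩, ?_⟩
      · change p (s y) ∈ E
        rwa [hR.apply_section]
      · change p (r • s y) = g y
        rw [hg, hR.apply_section]
  have hker : (LinearMap.ker q).map V.subtype =
      ((hR.comap ⊥ bot_stable).restrictScalars k).map (Algebra.lsmul k k H r) := by
    apply le_antisymm
    · rintro _ ⟨⟨_, x, hx, rfl⟩, hy, rfl⟩
      have h0 : p (r • x) = 0 := hy
      refine ⟨r • x, (Submodule.mem_bot k).2 h0, ?_⟩
      simp [← mul_smul, hr]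
    · rintro _ ⟨x, hx, rfl⟩
      have hx0 : p x = 0 := (Submodule.mem_bot k).1 hx
      refine ⟨⟨r • x, ⟨x, ?_, rfl⟩⟩, ?_, rfl⟩
      · change p x ∈ E
        rw [hx0]
        exact E.zero_mem
      · change p (r • x) = 0
        rw [hg, hx0, map_zero]
  have := LinearMap.finrank_range_add_finrank_ker q
  rw [hrange, ← Submodule.finrank_map_subtype_eq V, hker, add_comm] at this
  exact this.symm

end Realization

section Comparison

variable {k : Type w} [Field k] {R : Type u} [Ring R] [Algebra k R]
  {H : Type u} [AddCommGroup H] [Module k H] [Module R H] [IsScalarTower k R H]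
  {X : Type*} [AddCommGroup X] [Module k X]
  {Γ : Subalgebra k (Module.End k X)} {p : H →ₗ[k] X} {s : X →ₗ[k] H} [FiniteDimensional k H]

/-- A submodule with the same dimension vector as the preimage of a stable subspace `E₀` is
the preimage of a stable subspace whose dimension type agrees with that of `E₀`. -/
theorem IsRealization.exists_eq_comap (hR : IsRealization R Γ p s) {E₀ : Submodule k X}
    {hE₀ : ∀ g ∈ Γ, ∀ m ∈ E₀, g m ∈ E₀} {e : DimensionVector R}
    (h₀ : HasDimensionVector (hR.comap E₀ hE₀) e) {U : Submodule R H}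
    (hU : HasDimensionVector U e) :
    ∃ (E : Submodule k X) (hE : ∀ g ∈ Γ, ∀ m ∈ E, g m ∈ E), U = hR.comap E hE ∧
      ∀ g ∈ Γ, g * g = g → Module.finrank k (E.map g) = Module.finrank k (E₀.map g) := by
  obtain ⟨ε, hεε, hε, hgen⟩ := hR.exists_generator
  have hker : ∀ h, p h = 0 → h ∈ U := by
    apply hgen U
    -- Since `ε • H` lies in `ker p`, it lies in every preimage. So the preimage of `E₀` has the
    -- largest possible `ε`-rank, and `U` must attain it too.
    have htop : ((hR.comap E₀ hE₀).restrictScalars k).map (Algebra.lsmul k k H ε) =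
        LinearMap.range (Algebra.lsmul k k H ε) := by
      apply le_antisymm (LinearMap.map_le_range)
      rintro _ ⟨h, rfl⟩
      refine ⟨ε • h, ?_, ?_⟩
      · change p (ε • h) ∈ E₀
        rw [hε]
        exact E₀.zero_mem
      · simp [← mul_smul, hεε]
    have hrank := hU.smulRank_eq k hεε h₀
    rw [smulRank, smulRank, htop] at hrank
    have heq := Submodule.eq_of_le_of_finrank_eq LinearMap.map_le_range hrank
    intro h
    have : (Algebra.lsmul k k H ε) h ∈ (U.restrictScalars k).map (Algebra.lsmul k k H ε) := by
      rw [heq]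
      exact ⟨h, rfl⟩
    obtain ⟨u, hu, huh⟩ := this
    have huh' : ε • u = ε • h := huh
    rw [← huh']
    exact U.smul_mem ε hu
  have hE : ∀ g ∈ Γ, ∀ m ∈ (U.restrictScalars k).map p, g m ∈ (U.restrictScalars k).map p := by
    rintro g hg _ ⟨u, hu, rfl⟩
    obtain ⟨r, hr⟩ := hR.exists_lift g hg
    exact ⟨r • u, U.smul_mem r hu, hr u⟩
  have hUE : U = hR.comap _ hE := by
    apply le_antisymm
    · intro u hu
      exact ⟨u, hu, rfl⟩
    · rintro h ⟨u, hu, huh⟩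
      have h0 : h - u ∈ U := hker _ (by rw [map_sub, huh, sub_self])
      simpa using U.add_mem h0 hu
  refine ⟨_, hE, hUE, fun g hg hgg => ?_⟩
  obtain ⟨r, hrr, hr⟩ := hR.exists_idempotent_lift g hg hgg
  have hrank := hU.smulRank_eq k hrr h₀
  rw [hUE, hR.smulRank_comap _ hE hrr hr, hR.smulRank_comap E₀ hE₀ hrr hr] at hrank
  exact Nat.add_left_cancel hrank

end Comparison

/-! ### A criterion for isomorphism of projective varieties -/

section Isomorphic

variable {k : Type w} [Field k] {W : Type v} [AddCommGroup W] [Module k W] {E : Type u}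
  [AddCommGroup E] [Module k E] {V : Set (Projectivization k W)} {X : Set (Projectivization k E)}

/-- A surjective map given by forms is an isomorphism if locally it has linear retractions. -/
theorem isomorphic_of_surjective (ψ : V → X) (hψ : Function.Surjective ψ) {m : ℕ} (Φ : W → E)
    (hΦ : ∀ l : Module.Dual k E, IsForm m fun x => l (Φ x)) (hΦ0 : ∀ x : V, Φ x.1.rep ≠ 0)
    (hψΦ : ∀ x, (ψ x).1 = Projectivization.mk k (Φ x.1.rep) (hΦ0 x))
    (hret : ∀ x : V, ∃ (F : E →ₗ[k] W) (c : W → k), c x.1.rep ≠ 0 ∧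
      ∀ y : V, F (Φ y.1.rep) = c y.1.rep • y.1.rep) : Isomorphic X V := by
  have hretract : ∀ x : V, ∃ F : E →ₗ[k] W, F (ψ x).1.rep ≠ 0 ∧
      ∀ (y : V) (hy : F (ψ y).1.rep ≠ 0), y.1 = Projectivization.mk k (F (ψ y).1.rep) hy := by
    intro x
    obtain ⟨F, c, hc, hF⟩ := hret x
    -- The chosen representative of `ψ y` differs from `Φ` by a unit, which only rescales the
    -- recovered vector.
    have key : ∀ y : V, ∃ a : kˣ, F (ψ y).1.rep = (a * c y.1.rep) • y.1.rep := by
      intro y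
      obtain ⟨a, ha⟩ := Projectivization.exists_smul_eq_mk_rep k (Φ y.1.rep) (hΦ0 y)
      exact ⟨a, by rw [hψΦ, ← ha, Units.smul_def, map_smul, hF, smul_smul]⟩
    refine ⟨F, ?_, fun y hy => ?_⟩
    · obtain ⟨a, ha⟩ := key x
      rw [ha]
      exact smul_ne_zero (mul_ne_zero a.ne_zero hc) x.1.rep_nonzero
    · obtain ⟨a, ha⟩ := key y
      conv_lhs => rw [← y.1.mk_rep]
      rw [eq_comm, Projectivization.mk_eq_mk_iff']
      exact ⟨_, ha.symm⟩
  have hinj : Function.Injective ψ := by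
    intro x y hxy
    obtain ⟨F, hFx, hF⟩ := hretract x
    ext1
    have hFy : F (ψ y).1.rep ≠ 0 := hxy ▸ hFx
    rw [hF x hFx, hF y hFy]
    simp only [hxy]
  refine ⟨(Equiv.ofBijective ψ ⟨hinj, hψ⟩).symm, fun g => ?_, fun x => ?_⟩
  · obtain ⟨x, rfl⟩ := hψ g
    obtain ⟨F, hFx, hF⟩ := hretract x
    refine ⟨1, F, fun l => isForm_dual (l ∘ₗ F), hFx, fun g hg => ?_⟩
    obtain ⟨y, rfl⟩ := hψ g
    have hy : (Equiv.ofBijective ψ ⟨hinj, hψ⟩).symm (ψ y) = y :=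
      Equiv.ofBijective_symm_apply_apply ψ ⟨hinj, hψ⟩ y
    exact (congrArg Subtype.val hy).trans (hF y hg)
  · exact ⟨m, Φ, hΦ, hΦ0 x, fun y _ => hψΦ y⟩

end Isomorphic

/-! ### The quiver Grassmannian of a realization -/

section Plucker

variable {k : Type u} [Field k] {n d : ℕ} {R : Type u} [Ring R] [Algebra k R]
  {H : Type u} [AddCommGroup H] [Module k H] [Module R H] [IsScalarTower k R H]
  {A : Type u} [AddCommGroup A] [Module k A] {ι : A →ₗ[k] Module.Dual k (Forms k n (d + 1))}
  {p : H →ₗ[k] A × (Fin (n + 1) → k)} {s : A × (Fin (n + 1) → k) →ₗ[k] H}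

/-- A basis of the preimage of `⟨T⟩ × ⟨w⟩` that extends a basis `b` of `ker p`. -/
def lineBasis (s : A × (Fin (n + 1) → k) →ₗ[k] H) {r : ℕ} (b : Fin r → H) (T : A)
    (w : Fin (n + 1) → k) : Fin (r + 2) → H :=
  Fin.cons (s (T, 0)) (Fin.cons (s (0, w)) b : Fin (r + 1) → H)

theorem ιMulti_lineBasis {r : ℕ} (b : Fin r → H) (T : A) (w : Fin (n + 1) → k) :
    ExteriorAlgebra.ιMulti k (r + 2) (lineBasis s b T w) = ExteriorAlgebra.ι k (s (T, 0)) *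
      (ExteriorAlgebra.ι k (s (0, w)) * ExteriorAlgebra.ιMulti k r b) := by
  rw [ExteriorAlgebra.ιMulti_succ_apply, ExteriorAlgebra.ιMulti_succ_apply]
  rfl

/-- The wedge is bilinear in its first two vectors; one is linear in the evaluation functional, of
degree `d + 1` in `y`, the other linear in `y`. -/
theorem isForm_ιMulti_lineBasis {r : ℕ} (b : Fin r → H)
    (π : Module.Dual k (Forms k n (d + 1)) →ₗ[k] A) (l : Module.Dual k (ExteriorAlgebra k H)) :
    IsForm (d + 2) fun y : Fin (n + 1) → k =>
      l (ExteriorAlgebra.ιMulti k (r + 2) (lineBasis s b (π (evalForm (d + 1) y)) y)) := by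
  let f : Module.Dual k (Forms k n (d + 1)) →ₗ[k] ExteriorAlgebra k H :=
    ExteriorAlgebra.ι k ∘ₗ s ∘ₗ LinearMap.inl k _ _ ∘ₗ π
  let g : (Fin (n + 1) → k) →ₗ[k] ExteriorAlgebra k H :=
    LinearMap.mulRight k (ExteriorAlgebra.ιMulti k r b) ∘ₗ ExteriorAlgebra.ι k ∘ₗ s ∘ₗ
      LinearMap.inr k _ _
  have := isForm_bilinear_evalForm (((LinearMap.mul k (ExteriorAlgebra k H)).compl₁₂ f g).compr₂ l)
  convert this using 2 with y
  rw [ιMulti_lineBasis]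
  rfl

/-- A linear map that recovers `w` from the Plücker vector of the preimage of `⟨T⟩ × ⟨w⟩`. -/
theorem exists_linear_retraction (hps : ∀ x, p (s x) = x) {r : ℕ}
    (b : Module.Basis (Fin r) k (LinearMap.ker p)) (β : Module.Dual k A) :
    ∃ F : ExteriorAlgebra k H →ₗ[k] (Fin (n + 1) → k), ∀ T w,
      F (ExteriorAlgebra.ιMulti k (r + 2) (lineBasis s (fun i => (b i : H)) T w)) = β T • w := by
  let q : H →ₗ[k] LinearMap.ker p := LinearMap.codRestrict _ (LinearMap.id - s ∘ₗ p) fun h => by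
    rw [LinearMap.mem_ker, LinearMap.sub_apply, map_sub, LinearMap.comp_apply, hps,
      LinearMap.id_apply, sub_self]
  have hq : ∀ i, q (b i) = b i := fun i => by
    ext1
    change (b i : H) - s (p (b i)) = b i
    rw [(b i).2, map_zero, sub_zero]
  have hqs : ∀ x, q (s x) = 0 := fun x => by
    ext1
    change s x - s (p (s x)) = 0
    rw [hps, sub_self]
  -- Functionals chosen so that pairing them with the basis of the preimage gives a diagonal matrix
  -- with entries `β T`, `w i`, `1`, …, `1`. The determinant is linear on the exterior power and
  -- equals the `i`-th coordinate of `β T • w`.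
  let μ : Fin (n + 1) → Fin (r + 2) → Module.Dual k H := fun i =>
    Fin.cons (β ∘ₗ LinearMap.fst k _ _ ∘ₗ p)
      (Fin.cons (LinearMap.proj i ∘ₗ LinearMap.snd k _ _ ∘ₗ p) fun j => b.coord j ∘ₗ q)
  let D : Fin (n + 1) → H [⋀^Fin (r + 2)]→ₗ[k] k := fun i =>
    Matrix.detRowAlternating.compLinearMap (LinearMap.pi (μ i))
  refine ⟨LinearMap.pi fun i => ExteriorAlgebra.liftAlternating (Pi.single (r + 2) (D i)),
    fun T w => ?_⟩
  ext i
  rw [LinearMap.pi_apply, ExteriorAlgebra.liftAlternating_apply_ιMulti, Pi.single_eq_same]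
  have hdiag : (fun j => LinearMap.pi (μ i) (lineBasis s (fun i => (b i : H)) T w j) :
      Matrix (Fin (r + 2)) (Fin (r + 2)) k) =
      Matrix.diagonal (Fin.cons (β T) (Fin.cons (w i) fun _ => 1 : Fin (r + 1) → k)) := by
    have hpb : ∀ j, p (b j) = 0 := fun j => (b j).2
    ext a c
    refine Fin.cases ?_ (fun a => Fin.cases ?_ (fun a => ?_) a) a <;>
    refine Fin.cases ?_ (fun c => Fin.cases ?_ (fun c => ?_) c) c
    all_goals simp [lineBasis, μ, hps, hqs, hq, hpb, Matrix.diagonal_apply, Finsupp.single_apply,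
      Fin.ext_iff]
  change Matrix.det _ = _
  rw [hdiag, Matrix.det_diagonal, Fin.prod_univ_succ, Fin.prod_univ_succ]
  simp

theorem linearIndependent_lineBasis (hps : ∀ x, p (s x) = x) {r : ℕ}
    (b : Module.Basis (Fin r) k (LinearMap.ker p)) {T : A} {w : Fin (n + 1) → k} (hT : T ≠ 0)
    (hw : w ≠ 0) : LinearIndependent k (lineBasis s (fun i => (b i : H)) T w) := by
  have hb : LinearIndependent k (fun i => (b i : H)) :=
    b.linearIndependent.map' _ (Submodule.ker_subtype _)
  have hspan : Submodule.span k (Set.range fun i => (b i : H)) ≤ LinearMap.ker p :=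
    Submodule.span_le.2 (by rintro _ ⟨i, rfl⟩; exact (b i).2)
  rw [lineBasis, linearIndependent_finCons, linearIndependent_finCons]
  refine ⟨⟨hb, fun h => ?_⟩, fun h => ?_⟩
  · have := hspan h
    rw [LinearMap.mem_ker, hps] at this
    exact hw (congrArg Prod.snd this)
  · have hle : Submodule.span k (Set.range (Fin.cons (s (0, w)) (fun i => (b i : H)) :
        Fin (r + 1) → H)) ≤ LinearMap.ker (LinearMap.fst k _ _ ∘ₗ p) := by
      rw [Submodule.span_le]
      rintro _ ⟨i, rfl⟩
      refine Fin.cases ?_ (fun i => ?_) i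
      · simp [hps]
      · have : p (b i) = 0 := (b i).2
        simp [this]
    have := hle h
    rw [LinearMap.mem_ker, LinearMap.comp_apply, hps] at this
    exact hT this

theorem span_lineBasis (hps : ∀ x, p (s x) = x) {r : ℕ}
    (b : Module.Basis (Fin r) k (LinearMap.ker p)) (T : A) (w : Fin (n + 1) → k) :
    Submodule.span k (Set.range (lineBasis s (fun i => (b i : H)) T w)) =
      ((Submodule.span k {T}).prod (Submodule.span k {w})).comap p := by
  have hspan : Submodule.span k (Set.range fun i => (b i : H)) = LinearMap.ker p := by
    have := congrArg (Submodule.map (LinearMap.ker p).subtype) b.span_eq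
    rw [Submodule.map_span, ← Set.range_comp, Submodule.map_top, Submodule.range_subtype] at this
    exact this
  rw [lineBasis, Fin.range_cons, Submodule.span_insert, Fin.range_cons, Submodule.span_insert,
    hspan]
  apply le_antisymm
  · refine sup_le ?_ (sup_le ?_ ?_)
    · rw [Submodule.span_singleton_le_iff_mem, Submodule.mem_comap, hps]
      exact ⟨Submodule.mem_span_singleton_self T, Submodule.zero_mem _⟩
    · rw [Submodule.span_singleton_le_iff_mem, Submodule.mem_comap, hps]
      exact ⟨Submodule.zero_mem _, Submodule.mem_span_singleton_self w⟩
    · intro x hx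
      rw [Submodule.mem_comap, LinearMap.mem_ker.1 hx]
      exact Submodule.zero_mem _
  · rintro x ⟨h₁, h₂⟩
    obtain ⟨a, ha⟩ := Submodule.mem_span_singleton.1 h₁
    obtain ⟨c, hc⟩ := Submodule.mem_span_singleton.1 h₂
    have hx : x = a • s (T, 0) + (c • s (0, w) + (x - s (p x))) := by
      have : s (p x) = a • s (T, 0) + c • s (0, w) := by
        rw [← map_smul, ← map_smul, ← map_add]
        congr 1
        ext1
        · simpa using ha.symm
        · simpa using hc.symm
      rw [this]
      abel
    rw [hx]
    refine Submodule.add_mem_sup (Submodule.smul_mem _ _ (Submodule.mem_span_singleton_self _))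
      (Submodule.add_mem_sup (Submodule.smul_mem _ _ (Submodule.mem_span_singleton_self _)) ?_)
    rw [LinearMap.mem_ker, map_sub, hps, sub_self]

variable [FiniteDimensional k H]

/-- In the chain `ker p ⊂ p⁻¹(0 × ⟨w⟩) ⊂ p⁻¹(⟨T⟩ × ⟨w⟩)` the two factors are lines on which `r` acts
by the scalars `χ₂ r` and `χ₁ r`, which depend neither on `w` nor on `T`. -/
theorem IsRealization.exists_hasDimensionVector_comap
    (hR : IsRealization R (contractionAlgebra ι) p s) :
    ∃ e : DimensionVector R, ∀ (w : Fin (n + 1) → k) (T : A) (_ : w ≠ 0) (_ : T ≠ 0)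
      (h : ι T = evalForm (d + 1) w), HasDimensionVector (hR.comap _ (prod_stable h)) e := by
  have hnoeth : IsNoetherian R H := isNoetherian_of_tower k inferInstance
  have hart : IsArtinian R H := isArtinian_of_tower k inferInstance
  choose g hg hact using hR.exists_apply_smul
  choose χ₁ χ₂ q hχ using hg
  have hw_stable : ∀ w : Fin (n + 1) → k, ∀ g ∈ contractionAlgebra ι,
      ∀ m ∈ (⊥ : Submodule k A).prod (Submodule.span k {w}),
        g m ∈ (⊥ : Submodule k A).prod (Submodule.span k {w}) := by
    rintro w g ⟨a, b, q, hg⟩ ⟨m₁, m₂⟩ ⟨h₁, h₂⟩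
    rw [hg]
    have h₁ : m₁ = 0 := h₁
    subst h₁
    refine ⟨by simp, ?_⟩
    simpa using Submodule.smul_mem _ b h₂
  have step₁ : ∀ w : Fin (n + 1) → k, w ≠ 0 → IsLineExtension (k := k)
      (hR.comap ⊥ bot_stable) (hR.comap _ (hw_stable w)) (s (0, w)) := fun w hw =>
    hR.isLineExtension _ _ (by simpa using hw) fun y => by
      simp only [Submodule.mem_prod, Submodule.mem_bot, Submodule.mem_span_singleton,
        Prod.ext_iff]
      simp only [Prod.fst_sub, Prod.snd_sub, Prod.smul_fst, Prod.smul_snd, smul_zero, sub_zero,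
        Prod.fst_zero, Prod.snd_zero, sub_eq_zero]
      exact ⟨fun ⟨h, c, hc⟩ => ⟨c, h, hc.symm⟩, fun ⟨c, h, hc⟩ => ⟨h, c, hc.symm⟩⟩
  have step₂ : ∀ (w : Fin (n + 1) → k) (T : A) (_ : T ≠ 0) (h : ι T = evalForm (d + 1) w),
      IsLineExtension (k := k)
        (hR.comap _ (hw_stable w)) (hR.comap _ (prod_stable h)) (s (T, 0)) := fun w T hT h =>
    hR.isLineExtension _ _ (by simpa using hT) fun y => by
      simp only [Submodule.mem_prod, Submodule.mem_bot, Submodule.mem_span_singleton]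
      simp only [Prod.fst_sub, Prod.snd_sub, Prod.smul_fst, Prod.smul_snd, smul_zero, sub_zero,
        sub_eq_zero]
      exact ⟨fun ⟨⟨c, hc⟩, h⟩ => ⟨c, hc.symm, h⟩, fun ⟨c, hc, h⟩ => ⟨⟨c, hc.symm⟩, h⟩⟩
  have char₁ : ∀ (w : Fin (n + 1) → k) (r : R),
      r • s (0, w) - χ₂ r • s (0, w) ∈ hR.comap ⊥ bot_stable := fun w r => by
    rw [hR.mem_comap, map_sub, hact, map_smul, hR.apply_section, hχ, Submodule.mem_bot]
    simp
  have char₂ : ∀ (w : Fin (n + 1) → k) (T : A) (_ : ι T = evalForm (d + 1) w) (r : R),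
      r • s (T, 0) - χ₁ r • s (T, 0) ∈ hR.comap _ (hw_stable w) := fun w T h r => by
    rw [hR.mem_comap, map_sub, hact, map_smul, hR.apply_section, hχ, h, contraction_evalForm]
    refine ⟨by simp, ?_⟩
    simpa using Submodule.smul_mem _ _ (Submodule.mem_span_singleton_self w)
  by_cases hne : ∃ (w : Fin (n + 1) → k) (T : A), w ≠ 0 ∧ T ≠ 0 ∧ ι T = evalForm (d + 1) w
  · obtain ⟨w₀, T₀, hw₀, hT₀, h₀⟩ := hne
    obtain ⟨a, ha⟩ := exists_hasDimensionVector (hR.comap ⊥ bot_stable)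
    obtain ⟨b, hb⟩ := exists_hasDimensionVector (hR.comap _ (hw_stable w₀))
    obtain ⟨e, he⟩ := exists_hasDimensionVector (hR.comap _ (prod_stable h₀))
    refine ⟨e, fun w T hw hT h => ?_⟩
    have hb' := HasDimensionVector.of_lineExtension (step₁ w₀ hw₀) (step₁ w hw) χ₂
      (char₁ w₀) (char₁ w) ha ha hb
    exact HasDimensionVector.of_lineExtension (step₂ w₀ T₀ hT₀ h₀) (step₂ w T hT h) χ₁
      (char₂ w₀ T₀ h₀) (char₂ w T h) hb hb' he
  · exact ⟨fun _ => 0, fun w T hw hT h => absurd ⟨w, T, hw, hT, h⟩ hne⟩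

/-- The coordinate projections, followed by the injections of the factors, are idempotents of the
contraction algebra, and the injections preserve dimension. -/
theorem finrank_map_eq_of_contractionAlgebra {E E' : Submodule k (A × (Fin (n + 1) → k))}
    (h : ∀ g ∈ contractionAlgebra ι, g * g = g →
      Module.finrank k (E.map g) = Module.finrank k (E'.map g)) :
    Module.finrank k (E.map (LinearMap.fst k A (Fin (n + 1) → k))) =
      Module.finrank k (E'.map (LinearMap.fst k A (Fin (n + 1) → k))) ∧
    Module.finrank k (E.map (LinearMap.snd k A (Fin (n + 1) → k))) =
      Module.finrank k (E'.map (LinearMap.snd k A (Fin (n + 1) → k))) := by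
  constructor
  · obtain ⟨g, hg, hgm⟩ := exists_mem_contractionAlgebra_fst ι
    have hcomp : g = LinearMap.inl k A (Fin (n + 1) → k) ∘ₗ LinearMap.fst k _ _ :=
      LinearMap.ext hgm
    have := h g hg (LinearMap.ext fun m => by rw [Module.End.mul_apply, hgm, hgm])
    rwa [hcomp, Submodule.map_comp, Submodule.map_comp,
      ← LinearEquiv.finrank_eq (Submodule.equivMapOfInjective _ LinearMap.inl_injective _),
      ← LinearEquiv.finrank_eq (Submodule.equivMapOfInjective _ LinearMap.inl_injective _)] at this
  · obtain ⟨g, hg, hgm⟩ := exists_mem_contractionAlgebra_snd ι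
    have hcomp : g = LinearMap.inr k A (Fin (n + 1) → k) ∘ₗ LinearMap.snd k _ _ :=
      LinearMap.ext hgm
    have := h g hg (LinearMap.ext fun m => by rw [Module.End.mul_apply, hgm, hgm])
    rwa [hcomp, Submodule.map_comp, Submodule.map_comp,
      ← LinearEquiv.finrank_eq (Submodule.equivMapOfInjective _ LinearMap.inr_injective _),
      ← LinearEquiv.finrank_eq (Submodule.equivMapOfInjective _ LinearMap.inr_injective _)] at this

/-- The quiver Grassmannian of a realization of the contraction algebra is isomorphic to the variety
of all points whose evaluation lies in the range of `ι`. -/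
theorem IsRealization.exists_isomorphic
    (hR : IsRealization R (contractionAlgebra ι) p s) (hι : Function.Injective ι)
    {V : Set (Projectivization k (Fin (n + 1) → k))}
    (hV : ∀ x, x ∈ V ↔ evalForm (d + 1) x.rep ∈ LinearMap.range ι) :
    ∃ e : DimensionVector R, V.Nonempty → Isomorphic (quiverGrassmannian k (R := R) H e) V := by
  obtain ⟨e, he⟩ := hR.exists_hasDimensionVector_comap
  refine ⟨e, fun hVne => ?_⟩
  -- A linear left inverse of `ι` defines `T` for every vector `w`, not only over `V`, so that the
  -- Plücker vector is given by forms on all of `k^(n+1)`.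
  obtain ⟨π, hπ⟩ := LinearMap.exists_leftInverse_of_injective ι (LinearMap.ker_eq_bot.2 hι)
  obtain ⟨r, ⟨b⟩⟩ : ∃ r : ℕ, Nonempty (Module.Basis (Fin r) k (LinearMap.ker p)) :=
    ⟨_, ⟨Module.finBasis k _⟩⟩
  let t : (Fin (n + 1) → k) → A := fun w => π (evalForm (d + 1) w)
  let B : (Fin (n + 1) → k) → Fin (r + 2) → H := fun w => lineBasis s (fun i => (b i : H)) (t w) w
  have hps := hR.apply_section
  have ht : ∀ x ∈ V, ι (t x.rep) = evalForm (d + 1) x.rep := fun x hx => by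
    obtain ⟨T, hT⟩ := (hV x).1 hx
    have hπT : π (ι T) = T := LinearMap.congr_fun hπ T
    change ι (π _) = _
    rw [← hT, hπT]
  have ht0 : ∀ x ∈ V, t x.rep ≠ 0 := fun x hx h0 => by
    have := ht x hx
    rw [h0, map_zero] at this
    exact evalForm_ne_zero x.rep_nonzero this.symm
  have hB : ∀ x ∈ V, LinearIndependent k (B x.rep) := fun x hx =>
    linearIndependent_lineBasis hps b (ht0 x hx) x.rep_nonzero
  have hspan : ∀ (x) (hx : x ∈ V), Submodule.span k (Set.range (B x.rep)) =
      (hR.comap _ (prod_stable (ht x hx))).restrictScalars k := fun x hx => span_lineBasis hps b _ _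
  let ψ : V → quiverGrassmannian k (R := R) H e := fun x => ⟨pluckerPoint (B x.1.rep) (hB x.1 x.2),
    hR.comap _ (prod_stable (ht x.1 x.2)), he _ _ x.1.rep_nonzero (ht0 x.1 x.2) (ht x.1 x.2),
    r + 2, B x.1.rep, hB x.1 x.2, hspan x.1 x.2, rfl⟩
  have hsurj : Function.Surjective ψ := by
    rintro ⟨_, U, hU, m, c, hc, hcU, rfl⟩
    -- A point of `V` supplies the reference subspace of type `(1, 1)` with dimension vector `e`.
    obtain ⟨x₀, hx₀⟩ := hVne
    obtain ⟨E, hE, rfl, hrank⟩ := hR.exists_eq_comap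
      (he _ _ x₀.rep_nonzero (ht0 x₀ hx₀) (ht x₀ hx₀)) hU
    obtain ⟨h₁, h₂⟩ := finrank_map_eq_of_contractionAlgebra hrank
    rw [Submodule.prod_map_fst, finrank_span_singleton (ht0 x₀ hx₀)] at h₁
    rw [Submodule.prod_map_snd, finrank_span_singleton x₀.rep_nonzero] at h₂
    obtain ⟨w, T, hw, hT, rfl⟩ := exists_eq_prod_of_stable hι hE h₁ h₂
    let x : Projectivization k (Fin (n + 1) → k) := Projectivization.mk k w hw
    obtain ⟨a, ha⟩ := Projectivization.exists_smul_eq_mk_rep k w hw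
    -- The representative of `[w]` is `a • w`, and evaluation in degree `d + 1` scales by `a ^ (d +
    -- 1)`; neither line changes.
    have hev : evalForm (d + 1) x.rep = ι (((a : k) ^ (d + 1)) • T) := by
      rw [map_smul, hT, ← evalForm_smul]
      exact congrArg _ ha.symm
    have hx : x ∈ V := (hV x).2 ⟨_, hev.symm⟩
    have htx : t x.rep = ((a : k) ^ (d + 1)) • T := hι ((ht x hx).trans hev)
    refine ⟨⟨x, hx⟩, Subtype.ext (pluckerPoint_eq_of_span_eq (hB x hx) hc ?_)⟩
    rw [hspan x hx, hcU]
    have hxw : Submodule.span k {x.rep} = Submodule.span k {w} := by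
      have : x.rep = (a : k) • w := ha.symm
      rw [this, Submodule.span_singleton_smul_eq a.isUnit]
    have hxT : Submodule.span k {t x.rep} = Submodule.span k {T} := by
      rw [htx, Submodule.span_singleton_smul_eq (a.isUnit.pow _)]
    ext h
    simp only [Submodule.restrictScalars_mem, hR.mem_comap, hxw, hxT]
  refine isomorphic_of_surjective ψ hsurj (fun w => ExteriorAlgebra.ιMulti k (r + 2) (B w))
    (isForm_ιMulti_lineBasis _ π) (fun x => wedge_ne_zero (hB x.1 x.2)) (fun _ => rfl) fun x => ?_
  obtain ⟨β, hβ⟩ : ∃ β : Module.Dual k A, β (t x.1.rep) ≠ 0 := by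
    by_contra! h
    exact ht0 x.1 x.2 ((Module.forall_dual_apply_eq_zero_iff k _).1 h)
  obtain ⟨F, hF⟩ := exists_linear_retraction (s := s) hps b β
  exact ⟨F, fun w => β (t w), hβ, fun y => hF _ _⟩

end Plucker

/-! ### Maps through the control class -/

section HomThrough

variable {A : Type u} [Category.{v} A] [Preadditive A] [HasZeroObject A] [HasBinaryBiproducts A]
  {k : Type w} [Field k] [Linear k A] {C : ObjectProperty A}

theorem comp_mem_homThrough {X X' Y : A} (a : X' ⟶ X) {f : X ⟶ Y} (hf : f ∈ homThrough k C X Y) :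
    a ≫ f ∈ homThrough k C X' Y := by
  obtain ⟨Z, hZ, g, h, rfl⟩ := hf
  exact ⟨Z, hZ, a ≫ g, h, by simp⟩

theorem mem_homThrough_comp {X Y Y' : A} {f : X ⟶ Y} (hf : f ∈ homThrough k C X Y) (a : Y ⟶ Y') :
    f ≫ a ∈ homThrough k C X Y' := by
  obtain ⟨Z, hZ, g, h, rfl⟩ := hf
  exact ⟨Z, hZ, g, h ≫ a, by simp⟩

/-- All maps in a finite-dimensional space `Hom(X, C, Y)` factor through one object of `add C`. -/
theorem exists_addClosure_factor (X Y : A) [FiniteDimensional k (X ⟶ Y)] :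
    ∃ Z : A, AddClosure C Z ∧
      ∀ f ∈ homThrough k C X Y, ∃ (g : X ⟶ Z) (h : Z ⟶ Y), f = g ≫ h := by
  classical
  have key : ∀ t : Finset (X ⟶ Y), (∀ f ∈ t, f ∈ homThrough k C X Y) →
      ∃ Z : A, AddClosure C Z ∧ ∀ f ∈ Submodule.span k (t : Set (X ⟶ Y)),
        ∃ (g : X ⟶ Z) (h : Z ⟶ Y), f = g ≫ h := by
    intro t
    induction t using Finset.induction_on with
    | empty =>
      intro _
      obtain ⟨Z, hZ⟩ := HasZeroObject.zero (C := A)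
      refine ⟨Z, .zero Z hZ, fun f hf => ⟨0, 0, ?_⟩⟩
      simpa using hf
    | insert a t _ ih =>
      intro ht
      obtain ⟨Z, hZ, hfac⟩ := ih fun f hf => ht f (Finset.mem_insert_of_mem hf)
      obtain ⟨Z', hZ', g', h', ha⟩ := ht a (Finset.mem_insert_self a t)
      -- One object must serve the whole span. Each further spanning map adds a summand, and its
      -- coefficient is absorbed into the map to that summand.
      refine ⟨Z' ⊞ Z, .sum _ _ hZ' hZ, fun f hf => ?_⟩
      rw [Finset.coe_insert, Submodule.mem_span_insert] at hf
      obtain ⟨c, f', hf', rfl⟩ := hf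
      obtain ⟨g, h, rfl⟩ := hfac f' hf'
      exact ⟨biprod.lift (c • g') g, biprod.desc h' h, by simp [ha]⟩
  obtain ⟨t, ht⟩ := (IsNoetherian.noetherian (homThrough k C X Y) : (homThrough k C X Y).FG)
  obtain ⟨Z, hZ, h⟩ := key t fun f hf => ht ▸ Submodule.subset_span hf
  exact ⟨Z, hZ, ht ▸ h⟩

end HomThrough

/-! ### Finite-dimensional modules and controlled embeddings -/

section FiniteModules

variable {k : Type u} [Field k]

theorem finiteDimensional_hom {Λ : Type u} [Ring Λ] [Algebra k Λ] [FiniteDimensional k Λ]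
    (D Y : FGModuleCat.{u} Λ) : FiniteDimensional k (D ⟶ Y) := by
  let _ : Module k D := ModuleCat.moduleOfAlgebraModule D.obj
  let _ : Module k Y := ModuleCat.moduleOfAlgebraModule Y.obj
  have : IsScalarTower k Λ D := ModuleCat.isScalarTower_of_algebra_moduleCat D.obj
  have : IsScalarTower k Λ Y := ModuleCat.isScalarTower_of_algebra_moduleCat Y.obj
  have : Module.Finite k D := Module.Finite.trans Λ D
  have : Module.Finite k Y := Module.Finite.trans Λ Y
  let f : (D ⟶ Y) →ₗ[k] (D →ₗ[k] Y) :=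
    { toFun := fun g => g.hom.hom.restrictScalars k
      map_add' := fun _ _ => rfl
      map_smul' := fun _ _ => rfl }
  exact Module.Finite.of_injective f fun g h hgh =>
    FGModuleCat.hom_ext (LinearMap.restrictScalars_injective k hgh)

variable {Γ : Type u} [Ring Γ] [Algebra k Γ] {X : Type u} [AddCommGroup X] [Module k X]
  [Module Γ X] [IsScalarTower k Γ X] [Module.Finite Γ X]

/-- A module is the space of maps from the free module of rank one. -/
def homOfElement : X ≃ₗ[k] (FGModuleCat.of Γ Γ ⟶ FGModuleCat.of Γ X) where
  toFun x := FGModuleCat.ofHom (LinearMap.toSpanSingleton Γ X x)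
  invFun f := f.hom.hom (1 : Γ)
  map_add' x y := by
    apply FGModuleCat.hom_ext
    ext
    change (1 : Γ) • (x + y) = (1 : Γ) • x + (1 : Γ) • y
    rw [smul_add]
  map_smul' c x := by
    apply FGModuleCat.hom_ext
    ext
    change (1 : Γ) • (c • x) = algebraMap k Γ c • (1 : Γ) • x
    rw [one_smul, one_smul, algebraMap_smul]
  left_inv x := one_smul Γ x
  right_inv f := by
    apply FGModuleCat.hom_ext
    ext
    exact one_smul Γ _

theorem homOfElement_comp (γ : Γ) (x : X) :
    homOfElement (k := k) γ ≫ homOfElement (k := k) x =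
      (homOfElement (k := k) (γ • x) : FGModuleCat.of Γ Γ ⟶ FGModuleCat.of Γ X) := by
  apply FGModuleCat.hom_ext
  ext
  change ((1 : Γ) • γ) • x = (1 : Γ) • γ • x
  rw [one_smul, one_smul]

end FiniteModules

section Controlled

variable {k : Type u} [Field k] {Γ Λ : Type u} [Ring Γ] [Algebra k Γ] [Ring Λ] [Algebra k Λ]
  {X : Type u} [AddCommGroup X] [Module k X] [Module Γ X] [IsScalarTower k Γ X]
  [Module.Finite Γ X] {F : FGModuleCat.{u} Γ ⥤ FGModuleCat.{u} Λ}
  {C : ObjectProperty (FGModuleCat.{u} Λ)}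

theorem IsControlledEmbedding.exists_sub_mem (hF : IsControlledEmbedding k F C)
    {M N : FGModuleCat.{u} Γ} (f : F.obj M ⟶ F.obj N) :
    ∃ g : M ⟶ N, f - F.map g ∈ homThrough k C (F.obj M) (F.obj N) := by
  have := hF.additive
  have := hF.linear
  have hf : f ∈ LinearMap.range (F.mapLinearMap k : (M ⟶ N) →ₗ[k] _) ⊔
      homThrough k C (F.obj M) (F.obj N) := (hF.isCompl M N).sup_eq_top ▸ Submodule.mem_top
  obtain ⟨_, ⟨g, rfl⟩, h, hh, rfl⟩ := Submodule.mem_sup.1 hf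
  exact ⟨g, by simpa using hh⟩

/-- The projection of `Hom(FΓ, FX)` onto `X` along `Hom(FΓ, C, FX)`. -/
theorem IsControlledEmbedding.exists_projection (hF : IsControlledEmbedding k F C) :
    ∃ π : (F.obj (FGModuleCat.of Γ Γ) ⟶ F.obj (FGModuleCat.of Γ X)) →ₗ[k] X,
      (∀ x, π (F.map (homOfElement (k := k) x)) = x) ∧
        ∀ f, π f = 0 ↔ f ∈ homThrough k C _ _ := by
  have := hF.additive
  have := hF.linear
  have := hF.faithful
  let L : X →ₗ[k] (F.obj (FGModuleCat.of Γ Γ) ⟶ F.obj (FGModuleCat.of Γ X)) :=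
    F.mapLinearMap k ∘ₗ homOfElement.toLinearMap
  have hL : LinearMap.ker L = ⊥ := by
    rw [LinearMap.ker_eq_bot]
    exact F.map_injective.comp homOfElement.injective
  have hcompl : IsCompl (LinearMap.range L)
      (homThrough k C (F.obj (FGModuleCat.of Γ Γ)) (F.obj (FGModuleCat.of Γ X))) := by
    rw [LinearMap.range_comp_of_range_eq_top _ (LinearEquiv.range _)]
    exact hF.isCompl _ _
  refine ⟨LinearMap.linearProjOfIsCompl _ L (LinearMap.ker_eq_bot.1 hL) hcompl,
    fun x => LinearMap.linearProjOfIsCompl_apply_left _ L _ hcompl x, fun f => ?_⟩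
  rw [← LinearMap.mem_ker, LinearMap.ker_linearProjOfIsCompl]

end Controlled

/-! ### Realizing faithful modules by spaces of maps -/

section Realization

/-- The model is `Q = FΓ`, `Y = FX` and `Z` in `add C`. The summand `Z` is added so that maps killed
by `π` are generated by `Hom(Z, Y)`, the part of `Hom(Q ⊞ Z, Y)` cut out by an idempotent. The lifts
of idempotents come from the multiplicativity of `ρ`. -/
theorem isRealization_biprod {k : Type w} [Field k] {A : Type u} [Category.{v} A] [Preadditive A]
    [Linear k A] [HasBinaryBiproducts A] {X : Type*} [AddCommGroup X] [Module k X]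
    {Γ : Subalgebra k (Module.End k X)} {Q Y Z : A} {π : (Q ⟶ Y) →ₗ[k] X} {m : X →ₗ[k] (Q ⟶ Y)}
    (hπm : ∀ x, π (m x) = x) (hfac : ∀ f, π f = 0 → ∃ (g : Q ⟶ Z) (h : Z ⟶ Y), f = g ≫ h)
    (hZ : ∀ (g : Q ⟶ Z) (h : Z ⟶ Y), π (g ≫ h) = 0)
    (hQ : ∀ φ : Q ⟶ Q, ∃ γ : Γ, ∀ f, π (φ ≫ f) = γ • π f) {ρ : Γ → (Q ⟶ Q)}
    (hρ : ∀ γ f, π (ρ γ ≫ f) = γ • π f) (hρρ : ∀ γ γ', ρ γ ≫ ρ γ' = ρ (γ * γ')) :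
    IsRealization (End (Q ⊞ Z))ᵐᵒᵖ Γ (π ∘ₗ Linear.leftComp k Y (biprod.inl : Q ⟶ Q ⊞ Z))
      (Linear.leftComp k Y (biprod.fst : Q ⊞ Z ⟶ Q) ∘ₗ m) := by
  have hlift : ∀ (γ : Γ) (f : Q ⊞ Z ⟶ Y),
      π (biprod.inl ≫ (biprod.fst ≫ ρ γ ≫ biprod.inl : Q ⊞ Z ⟶ Q ⊞ Z) ≫ f) =
        γ • π (biprod.inl ≫ f) :=
    fun γ f => by simp [← hρ]
  refine ⟨fun x => ?_, fun r => ?_, fun g hg => ?_, fun g hg hgg => ?_, ?_⟩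
  · simp [hπm]
  · obtain ⟨r⟩ := r
    change Q ⊞ Z ⟶ Q ⊞ Z at r
    obtain ⟨γ, hγ⟩ := hQ (biprod.inl ≫ r ≫ biprod.fst)
    refine ⟨γ.1, γ.2, fun f => ?_⟩
    change π (biprod.inl ≫ r ≫ f) = γ • π (biprod.inl ≫ f)
    -- Splitting `f` over the two summands: the part passing through `Z` is killed by `π`, and only
    -- the `Q`-to-`Q` entry of `r` acts on `X`.
    have h1 : biprod.inl ≫ r ≫ f = (biprod.inl ≫ r ≫ biprod.fst) ≫ biprod.inl ≫ f +
        (biprod.inl ≫ r ≫ biprod.snd) ≫ biprod.inr ≫ f := by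
      have h2 : f = biprod.fst ≫ biprod.inl ≫ f + biprod.snd ≫ biprod.inr ≫ f := by
        rw [← Category.assoc, ← Category.assoc, ← Preadditive.add_comp, biprod.total,
          Category.id_comp]
      conv_lhs => rw [h2]
      simp only [Preadditive.comp_add, Category.assoc]
    rw [h1, map_add, hγ, hZ, add_zero]
  · exact ⟨MulOpposite.op (biprod.fst ≫ ρ ⟨g, hg⟩ ≫ biprod.inl : Q ⊞ Z ⟶ Q ⊞ Z), hlift ⟨g, hg⟩⟩
  · refine ⟨MulOpposite.op (biprod.fst ≫ ρ ⟨g, hg⟩ ≫ biprod.inl : Q ⊞ Z ⟶ Q ⊞ Z),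
      congrArg MulOpposite.op ?_, hlift ⟨g, hg⟩⟩
    change (biprod.fst ≫ ρ ⟨g, hg⟩ ≫ biprod.inl) ≫ (biprod.fst ≫ ρ ⟨g, hg⟩ ≫ biprod.inl) = _
    have hγ : (⟨g, hg⟩ * ⟨g, hg⟩ : Γ) = ⟨g, hg⟩ := Subtype.ext hgg
    simp only [Category.assoc, biprod.inl_fst_assoc]
    rw [← Category.assoc (ρ _) (ρ _), hρρ, hγ]
  · refine ⟨MulOpposite.op (biprod.snd ≫ biprod.inr : Q ⊞ Z ⟶ Q ⊞ Z),
      congrArg MulOpposite.op ?_, fun f => ?_, fun U hU f hf => ?_⟩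
    · change (biprod.snd ≫ biprod.inr) ≫ (biprod.snd ≫ biprod.inr) = _
      simp
    · change π (biprod.inl ≫ (biprod.snd ≫ biprod.inr) ≫ f) = 0
      simp
    · obtain ⟨g, h, hgh⟩ := hfac _ hf
      let a : End (Q ⊞ Z) := biprod.fst ≫ g ≫ biprod.inr
      let e : End (Q ⊞ Z) := biprod.snd ≫ biprod.inr
      -- On `Q` the map `f` is `g ≫ h`, obtained from `h` on `Z` by the action of `a`; on `Z` it is
      -- `e • f`. Both terms lie in the submodule generated by `e • H`.
      have h1 : f = MulOpposite.op a • MulOpposite.op e • (biprod.snd ≫ h) +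
          MulOpposite.op e • f := by
        change f = (biprod.fst ≫ g ≫ biprod.inr) ≫ (biprod.snd ≫ biprod.inr) ≫
          (biprod.snd ≫ h) + (biprod.snd ≫ biprod.inr) ≫ f
        apply biprod.hom_ext'
        · simpa using hgh
        · simp
      rw [h1]
      exact U.add_mem (U.smul_mem _ (hU _)) (hU _)

variable {k : Type u} [Field k] {Λ : Type u} [Ring Λ] [Algebra k Λ] [FiniteDimensional k Λ]
  {X : Type u} [AddCommGroup X] [Module k X] [FiniteDimensional k X]

/-- Over a controlled wild algebra every faithful module over a finite-dimensional algebra is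
realized by some `Hom(D, Y)`. -/
theorem IsControlledWild.exists_isRealization (hΛ : IsControlledWild k Λ)
    (Γ : Subalgebra k (Module.End k X)) :
    ∃ (D Y : FGModuleCat.{u} Λ) (p : (D ⟶ Y) →ₗ[k] X) (s : X →ₗ[k] (D ⟶ Y)),
      IsRealization (End D)ᵐᵒᵖ Γ p s := by
  have : Module.Finite Γ X := Module.Finite.of_restrictScalars_finite k Γ X
  obtain ⟨F, C, hF⟩ := hΛ Γ
  have := hF.additive
  have := hF.linear
  have := finiteDimensional_hom (k := k) (F.obj (FGModuleCat.of Γ Γ)) (F.obj (FGModuleCat.of Γ X))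
  obtain ⟨π, hπ, hπ0⟩ := hF.exists_projection (X := X)
  obtain ⟨Z, hZ, hfac⟩ := exists_addClosure_factor (k := k) (C := C)
    (F.obj (FGModuleCat.of Γ Γ)) (F.obj (FGModuleCat.of Γ X))
  have hρ : ∀ (γ : Γ) f, π (F.map (homOfElement (k := k) γ) ≫ f) = γ • π f := fun γ f => by
    -- Splitting `f` into its `F`-part and a map through `add C`; the latter stays in the kernel of
    -- `π` under composition, so `π` is `Γ`-linear.
    have h1 : F.map (homOfElement (k := k) γ) ≫ f = F.map (homOfElement (k := k) (γ • π f)) +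
        F.map (homOfElement (k := k) γ) ≫ (f - F.map (homOfElement (k := k) (π f))) := by
      rw [← homOfElement_comp, F.map_comp, Preadditive.comp_sub]
      abel
    have h2 : π (f - F.map (homOfElement (k := k) (π f))) = 0 := by rw [map_sub, hπ, sub_self]
    rw [h1, map_add, hπ, (hπ0 _).2 (comp_mem_homThrough _ ((hπ0 _).1 h2)), add_zero]
  refine ⟨_, _, _, _, isRealization_biprod (Z := Z) (m := F.mapLinearMap k ∘ₗ
    homOfElement.toLinearMap) hπ (fun f hf => hfac f ((hπ0 f).1 hf))
    (fun g h => (hπ0 _).2 ⟨Z, hZ, g, h, rfl⟩) (fun φ => ?_) hρ fun γ γ' => ?_⟩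
  · obtain ⟨φ', hφ⟩ := hF.exists_sub_mem φ
    obtain ⟨γ, rfl⟩ := (homOfElement (k := k)).surjective φ'
    refine ⟨γ, fun f => ?_⟩
    rw [← hρ, ← sub_eq_zero, ← map_sub, ← Preadditive.sub_comp, hπ0]
    exact mem_homThrough_comp hφ f
  · rw [← F.map_comp, homOfElement_comp, smul_eq_mul]

end Realization

/-! ### The empty variety -/

section Empty

/-- For `Y = 0` the only submodule has no composition factors, so a dimension vector with a positive
entry is not attained. Such an entry needs a simple `End(D)ᵒᵖ`-module, hence `D ≠ 0`; the image of
`k` under a faithful functor from `mod k` is such a `D`. -/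
theorem exists_isEmpty_auslanderVariety {k : Type u} [Field k] {Λ : Type u} [Ring Λ] [Algebra k Λ]
    (hΛ : IsControlledWild k Λ) :
    ∃ (D Y : FGModuleCat.{u} Λ) (e : DimensionVector (End D)ᵐᵒᵖ),
      auslanderVariety k D Y e = ∅ := by
  obtain ⟨F, C, hF⟩ := hΛ k
  have := hF.additive
  have := hF.faithful
  let D := F.obj (FGModuleCat.of k k)
  obtain ⟨Y, hY⟩ := HasZeroObject.zero (C := FGModuleCat.{u} Λ)
  have hnt : Nontrivial (End D)ᵐᵒᵖ := by
    refine ⟨1, 0, fun h => ?_⟩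
    have h0 : 𝟙 D = 0 := congrArg MulOpposite.unop h
    have h1 : 𝟙 (FGModuleCat.of k k) = 0 := F.map_injective (by rw [F.map_id, F.map_zero]; exact h0)
    exact one_ne_zero (congrArg
      (fun f : FGModuleCat.of k k ⟶ FGModuleCat.of k k => f.hom.hom (1 : k)) h1)
  obtain ⟨I, hI⟩ := Ideal.exists_maximal (End D)ᵐᵒᵖ
  have hsimple : IsSimpleModule (End D)ᵐᵒᵖ ((End D)ᵐᵒᵖ ⧸ I) := isSimpleModule_iff_isCoatom.2 hI.out
  refine ⟨D, Y, fun _ => 1, Set.eq_empty_of_forall_notMem ?_⟩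
  rintro _ ⟨U, ⟨s, -, -, hs⟩, -⟩
  have hsub : Subsingleton (D ⟶ Y) := ⟨fun f g => hY.eq_of_tgt f g⟩
  have h1 := hs ⟨ModuleCat.of _ ((End D)ᵐᵒᵖ ⧸ I), hsimple⟩
  have : IsEmpty (Fin s.length) := ⟨fun i => (s.lt_succ i).ne (Subsingleton.elim _ _)⟩
  rw [jhMultiplicity, Nat.card_of_isEmpty] at h1
  exact zero_ne_one h1

theorem isomorphic_empty {k : Type*} [Field k] {W : Type*} [AddCommGroup W] [Module k W]
    {W' : Type*} [AddCommGroup W'] [Module k W'] :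
    Isomorphic (∅ : Set (Projectivization k W)) (∅ : Set (Projectivization k W')) :=
  ⟨Equiv.equivOfIsEmpty _ _, fun x => x.2.elim, fun x => x.2.elim⟩

end Empty

end AuslanderVariety

theorem proposition1 (k : Type u) [Field k] [IsAlgClosed k]
    (Λ : Type u) [Ring Λ] [Algebra k Λ] [FiniteDimensional k Λ]
    (hΛ : AuslanderVariety.IsControlledWild k Λ)
    (n : ℕ) (V : Set (Projectivization k (Fin (n + 1) → k)))
    (hV : AuslanderVariety.IsProjectiveVariety V) :
    ∃ (D Y : FGModuleCat.{u} Λ) (e : AuslanderVariety.DimensionVector (End D)ᵐᵒᵖ),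
      AuslanderVariety.Isomorphic (AuslanderVariety.auslanderVariety k D Y e) V := by
  obtain rfl | hne := V.eq_empty_or_nonempty
  · obtain ⟨D, Y, e, he⟩ := AuslanderVariety.exists_isEmpty_auslanderVariety hΛ
    exact ⟨D, Y, e, he ▸ AuslanderVariety.isomorphic_empty⟩
  · obtain ⟨d, I, hI⟩ := hV.exists_dualAnnihilator
    obtain ⟨D, Y, p, s, hR⟩ := hΛ.exists_isRealization
      (X := I.dualAnnihilator × (Fin (n + 1) → k))
      (AuslanderVariety.contractionAlgebra I.dualAnnihilator.subtype)
    have := AuslanderVariety.finiteDimensional_hom (k := k) D Y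
    obtain ⟨e, he⟩ := hR.exists_isomorphic (Submodule.subtype_injective _) (V := V)
      (fun x => by rw [hI, Submodule.range_subtype])
    exact ⟨D, Y, e, he hne⟩
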